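/- Let $C$ be a copula on $[0,1]^m$ (the joint distribution function of a random vector with coordinates uniform on $[0,1]$) having a density $c\ge 0$ with respect to Lebesgue measure on $[0,1]^m$. For $j=1,\dots,m$ let $F_j$ be the distribution function of a probability measure on $\mathbb R$ without singular continuous part, i.e. of the form $f_j(t)\,dt+\nu_j$ with $f_j\ge 0$ measurable and $\nu_j$ carried by a countable set; either part may vanish. Write $F_j(t^-)$ for the left limit, $F_j^{-1}(u)=\inf\{t: u\le F_j(t)\}$ for the quantile function, and $J_j$ for the (countable) set of discontinuities of $F_j$, with counting measure $\delta_{J_j}=\sum_{t\in J_j}\delta_t$. For $x\in\mathbb R^m$ let $\mathcal C(x)=\{j: F_j \text{ is continuous at } x_j\}$, $\mathcal D(x)=\{1,\dots,m\}\setminus\mathcal C(x)$, $b_j=F_j(x_j)$ and $a_j=F_j(x_j^-)$. For a set $S$ of indices with complement $S^c$ let $$c_S(u_S)=\int_{[0,1]^{S^c}}c(u_S,v)\,dv,\qquad c_{S^c|S}(v\mid u_S)=\frac{c(u_S,v)}{c_S(u_S)},\qquad C_{S^c|S}(v\mid u_S)=\int_{[0,1]^{S^c}\cap(-\infty,v]}c_{S^c|S}(w\mid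 u_S)\,dw,$$ and for a function $g$ on $\mathbb R^k$ let $\triangle_{a}^{b}g=\sum_{T\subseteq\{1,\dots,k\}}(-1)^{|T|}g(z^T)$, where $z^T_j=a_j$ for $j\in T$ and $z^T_j=b_j$ for $j\notin T$. Let $U=(U_1,\dots,U_m)$ be a random vector with distribution function $C$, and let $X=(X_1,\dots,X_m)$ be a random vector on the same probability space such that almost surely $U_j=F_j(X_j)$ for all $j\in\mathcal C(X)$ and $X_j=F_j^{-1}(U_j)$ for all $j\in\mathcal D(X)$. Then: (i) $(X,U)$ has the joint density $$f(x,u)=c(u)\prod_{j\in\mathcal C(x)}\mathbf 1\{u_j=F_j(x_j)\}\prod_{j\in\mathcal D(x)}\mathbf 1\{F_j(x_j^-)\le u_j<F_j(x_j)\}$$ with respect to the measure $du\prod_{j}\delta_{F_j^{-1}(u_j)}(dx_j)$, where $du$ is Lebesgue measure on $[0,1]^m$; the same function is also its density with respect to the mixed measure $\prod_{j}\big(f_j(x_j)\,dx_j\,\delta_{F_j(x_j)}(du_j)+\delta_{J_j}(dx_j)\,du_j\big)$. (ii) $X$ has the density $$f(x)=c_{\mathcal C(x)}(b_{\mathcal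 C(x)})\prod_{j\in\mathcal C(x)}f_j(x_j)\;\triangle_{a_{\mathcal D(x)}}^{b_{\mathcal D(x)}}C_{\mathcal D(x)|\mathcal C(x)}(\,\cdot\mid b_{\mathcal C(x)})$$ with respect to the measure $\prod_{j}\big(dx_j+\delta_{J_j}(dx_j)\big)$. (iii) For almost every $x$ with respect to the law of $X$, the conditional distribution of $U_{\mathcal D(x)}$ given $X=x$ has the density $$f(u_{\mathcal D(x)}\mid x)=\frac{c_{\mathcal D(x)|\mathcal C(x)}(u_{\mathcal D(x)}\mid b_{\mathcal C(x)})\prod_{j\in\mathcal D(x)}\mathbf 1\{a_j\le u_j<b_j\}}{\triangle_{a_{\mathcal D(x)}}^{b_{\mathcal D(x)}}C_{\mathcal D(x)|\mathcal C(x)}(\,\cdot\mid b_{\mathcal C(x)})}$$ with respect to Lebesgue measure on $\mathbb R^{\mathcal D(x)}$. -/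

import Mathlib

open MeasureTheory ProbabilityTheory

noncomputable section

namespace MixedCopula

variable {ι : Type*} [Fintype ι] [DecidableEq ι]

/-- A copula, given on all of `ℝ^ι`: the joint distribution function of a random vector whose
coordinates are uniformly distributed on `[0,1]`. -/
def IsCopula (C : (ι → ℝ) → ℝ) : Prop :=
  ∃ κ : Measure (ι → ℝ), IsProbabilityMeasure κ ∧
    (∀ j, κ.map (fun u => u j) = (volume : Measure ℝ).restrict (Set.Icc 0 1)) ∧
    ∀ u, C u = κ.real (Set.Iic u)

/-- `c` is a density of the copula `C` with respect to Lebesgue measure on `[0,1]^ι`. -/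
structure IsCopulaDensity (C c : (ι → ℝ) → ℝ) : Prop where
  measurable : Measurable c
  nonneg : ∀ u, 0 ≤ c u
  eq_integral : ∀ u ∈ Set.Icc (0 : ι → ℝ) 1, C u = ∫ v in Set.Icc 0 u, c v

/-- `μ` has no singular continuous part, and `f` is the density of its absolutely continuous
part: `μ = f(t) dt + ν` with `ν` carried by a countable set. -/
structure IsMixedMarginal (μ : Measure ℝ) (f : ℝ → ℝ) : Prop where
  measurable : Measurable f
  nonneg : ∀ t, 0 ≤ f t
  decomp : ∃ (ν : Measure ℝ) (T : Set ℝ), T.Countable ∧ ν Tᶜ = 0 ∧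
    μ = (volume : Measure ℝ).withDensity (fun t => ENNReal.ofReal (f t)) + ν

/-- The quantile function `F⁻¹(u) = inf {t | u ≤ F(t)}` of the distribution `μ`
(meaningful for `0 < u < 1`). -/
def quantile (μ : Measure ℝ) (u : ℝ) : ℝ := sInf {t : ℝ | u ≤ cdf μ t}

/-- The points at which the distribution function of `μ` jumps. -/
def jumps (μ : Measure ℝ) : Set ℝ := {t | ¬ ContinuousAt (cdf μ) t}

/-- `b_j = F_j(x_j)`. -/
def upper (μ : ι → Measure ℝ) (x : ι → ℝ) : ι → ℝ := fun j => cdf (μ j) (x j)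

/-- `a_j = F_j(x_j⁻)`. -/
def lower (μ : ι → Measure ℝ) (x : ι → ℝ) : ι → ℝ :=
  fun j => Function.leftLim (cdf (μ j)) (x j)

open Classical in
/-- `𝒞(x)`: the indices `j` for which `F_j` is continuous at `x_j`. -/
def contIdx (μ : ι → Measure ℝ) (x : ι → ℝ) : Finset ι :=
  Finset.univ.filter fun j => ContinuousAt (cdf (μ j)) (x j)

/-- `𝒟(x)`: the remaining indices. -/
abbrev discIdx (μ : ι → Measure ℝ) (x : ι → ℝ) : Finset ι := (contIdx μ x)ᶜ

/-- The point of `ℝ^ι` with coordinates `u` on `S` and `v` off `S`. -/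
def glue (S : Finset ι) (u : S → ℝ) (v : ↥Sᶜ → ℝ) : ι → ℝ :=
  fun j => if h : j ∈ S then u ⟨j, h⟩ else v ⟨j, Finset.mem_compl.mpr h⟩

/-- The marginal copula density `c_S(u)`. -/
def margDensity (c : (ι → ℝ) → ℝ) (S : Finset ι) (u : S → ℝ) : ℝ :=
  ∫ v in Set.Icc (0 : ↥Sᶜ → ℝ) 1, c (glue S u v)

/-- The conditional copula density `c_{Sᶜ | S}(v | u)`. -/
def condDensity (c : (ι → ℝ) → ℝ) (S : Finset ι) (v : ↥Sᶜ → ℝ) (u : S → ℝ) : ℝ :=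
  c (glue S u v) / margDensity c S u

/-- The conditional copula distribution function `C_{Sᶜ | S}(v | u)`. -/
def condCopula (c : (ι → ℝ) → ℝ) (S : Finset ι) (v : ↥Sᶜ → ℝ) (u : S → ℝ) : ℝ :=
  ∫ w in Set.Icc (0 : ↥Sᶜ → ℝ) 1 ∩ Set.Iic v, condDensity c S w u

/-- The rectangle difference `Δ_a^b g`, a signed sum over the `2^k` vertices of the box with
corners `a` and `b`; a vertex with coordinate `a_j` exactly for `j ∈ T` has sign `(-1)^|T|`. -/
def rectDiff {κ : Type*} [Fintype κ] [DecidableEq κ] (a b : κ → ℝ) (g : (κ → ℝ) → ℝ) : ℝ :=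
  ∑ T : Finset κ, (-1 : ℝ) ^ T.card * g (fun j => if j ∈ T then a j else b j)

/-- `Δ_{a_𝒟(x)}^{b_𝒟(x)} C_{𝒟(x) | 𝒞(x)}(· | b_𝒞(x))`. -/
def condRectDiff (c : (ι → ℝ) → ℝ) (μ : ι → Measure ℝ) (x : ι → ℝ) : ℝ :=
  rectDiff ((discIdx μ x).restrict (lower μ x)) ((discIdx μ x).restrict (upper μ x))
    fun v => condCopula c (contIdx μ x) v ((contIdx μ x).restrict (upper μ x))

open Classical in
/-- The joint density `f(x,u)`. -/
def jointDensity (c : (ι → ℝ) → ℝ) (μ : ι → Measure ℝ) (x u : ι → ℝ) : ℝ :=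
  c u * (∏ j ∈ contIdx μ x, if u j = upper μ x j then 1 else 0) *
    ∏ j ∈ discIdx μ x, if lower μ x j ≤ u j ∧ u j < upper μ x j then 1 else 0

/-- The likelihood `f(x)`. -/
def likelihood (c : (ι → ℝ) → ℝ) (μ : ι → Measure ℝ) (f : ι → ℝ → ℝ) (x : ι → ℝ) : ℝ :=
  margDensity c (contIdx μ x) ((contIdx μ x).restrict (upper μ x)) *
    (∏ j ∈ contIdx μ x, f j (x j)) * condRectDiff c μ x

open Classical in
/-- The conditional density `f(v | x)` of the latent variables with index in `𝒟(x)`. -/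
def latentDensity (c : (ι → ℝ) → ℝ) (μ : ι → Measure ℝ) (x : ι → ℝ)
    (v : ↥(discIdx μ x) → ℝ) : ℝ :=
  condDensity c (contIdx μ x) v ((contIdx μ x).restrict (upper μ x)) *
      (∏ j : ↥(discIdx μ x), if lower μ x j ≤ v j ∧ v j < upper μ x j then 1 else 0) /
    condRectDiff c μ x

/-- The measure `du ∏_j δ_{F_j⁻¹(u_j)}(dx_j)` in the pair `(x, u)`, with `du` Lebesgue measure
on `[0,1]^ι`. -/
def quantileMeasure (μ : ι → Measure ℝ) : Measure ((ι → ℝ) × (ι → ℝ)) :=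
  ((volume : Measure (ι → ℝ)).restrict (Set.Icc 0 1)).map
    fun u => (fun j => quantile (μ j) (u j), u)

/-- The measure `∏_j (f_j(x_j) dx_j δ_{F_j(x_j)}(du_j) + δ_{J_j}(dx_j) du_j)` in the pair
`(x, u)`, where `δ_{J_j}` is counting measure on the set of jumps of `F_j`. -/
def mixedJointMeasure (μ : ι → Measure ℝ) (f : ι → ℝ → ℝ) : Measure ((ι → ℝ) × (ι → ℝ)) :=
  (Measure.pi fun j =>
      ((volume : Measure ℝ).withDensity fun t => ENNReal.ofReal (f j t)).map
          (fun t => (t, cdf (μ j) t)) +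
        (Measure.count.restrict (jumps (μ j))).prod (volume : Measure ℝ)).map
    fun p => (fun j => (p j).1, fun j => (p j).2)

/-- The measure `∏_j (dx_j + δ_{J_j}(dx_j))`, where `δ_{J_j}` is counting measure on the set of
jumps of `F_j`. -/
def mixedMeasure (μ : ι → Measure ℝ) : Measure (ι → ℝ) :=
  Measure.pi fun j => (volume : Measure ℝ) + Measure.count.restrict (jumps (μ j))

end MixedCopula

end

/-!
Almost surely `X = (F_j⁻¹(U_j))_j`, so the joint law of `(X, U)` is the image of `c(u) du` under
`u ↦ (F⁻¹(u), u)`. In each coordinate the image of Lebesgue measure on `[0,1]` under this map is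
also the image of `(dt + δ_J(dt)) ⊗ dv`, weighted by `f(t)` off the jumps and by
`1{F(t⁻) ≤ v < F(t)}` at the jumps, under `(t, v) ↦ (t, u)`, where `u = F(t)` off the jumps and
`u = v` at the jumps. The reference measure is now a product of a measure in `x` and one in `v`, so
integrating `v` out gives the law of `X`, and normalizing in `v` gives the conditional law of `U`.
By inclusion and exclusion the integral of `c` over the box of the jump coordinates is the rectangle
difference of the conditional copula. These integrals of `c` are finite for almost every value of
`X`: the coordinates of `U` off the jumps are the values `F_j(X_j)`, and almost every section of the
integrable function `c` is integrable.
-/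

noncomputable section

namespace MixedCopula

open scoped ENNReal

section ProductMeasures

variable {ι : Type*} {α : ι → Type*} [∀ i, MeasurableSpace (α i)] {μ : ∀ i, Measure (α i)}

theorem lmarginal_lmarginal_self [DecidableEq ι] [∀ i, IsProbabilityMeasure (μ i)]
    (g : (∀ i, α i) → ℝ≥0∞) (s : Finset ι) :
    ∫⋯∫⁻_s, ∫⋯∫⁻_s, g ∂μ ∂μ = ∫⋯∫⁻_s, g ∂μ := by
  funext x
  have hconst : ∀ y, (∫⋯∫⁻_s, g ∂μ) (Function.updateFinset x s y) = (∫⋯∫⁻_s, g ∂μ) x :=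
    fun y => lmarginal_congr _ _ fun i hi => dif_neg hi
  rw [lmarginal]
  simp only [hconst, lintegral_const, measure_univ, mul_one]

theorem ae_lmarginal_lt_top [Fintype ι] [DecidableEq ι] [∀ i, IsProbabilityMeasure (μ i)]
    {g : (∀ i, α i) → ℝ≥0∞} (hg : Measurable g) (hfin : ∫⁻ x, g x ∂Measure.pi μ ≠ ∞)
    (s : Finset ι) : ∀ᵐ x ∂Measure.pi μ, (∫⋯∫⁻_s, g ∂μ) x < ∞ := by
  refine ae_lt_top (hg.lmarginal μ) ?_
  rwa [lintegral_eq_of_lmarginal_eq s (hg.lmarginal μ) hg (lmarginal_lmarginal_self g s)]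

variable [∀ i, SigmaFinite (μ i)] {f : ∀ i, α i → ℝ≥0∞}

theorem lmarginal_prod [Fintype ι] [DecidableEq ι] (hf : ∀ i, Measurable (f i)) (s : Finset ι)
    (x : ∀ i, α i) :
    (∫⋯∫⁻_s, (fun x => ∏ i, f i (x i)) ∂μ) x =
      (∏ i ∈ s, ∫⁻ t, f i t ∂μ i) * ∏ i ∈ sᶜ, f i (x i) := by
  induction s using Finset.induction generalizing x with
  | empty => simp
  | insert i s hi ih =>
    have hprod : Measurable fun x : ∀ i, α i => ∏ i, f i (x i) :=
      Finset.measurable_fun_prod _ fun i _ => (hf i).comp (measurable_pi_apply i)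
    have hs : sᶜ = insert i (insert i s)ᶜ := by
      rw [Finset.compl_insert, Finset.insert_erase (Finset.mem_compl.2 hi)]
    have hupdate : ∀ t, ∏ j ∈ sᶜ, f j (Function.update x i t j) =
        f i t * ∏ j ∈ (insert i s)ᶜ, f j (x j) := fun t => by
      rw [hs, Finset.prod_insert (by simp), Function.update_self]
      congr 1
      refine Finset.prod_congr rfl fun j hj => ?_
      rw [Function.update_of_ne (by rintro rfl; simp at hj)]
    simp_rw [lmarginal_insert _ hprod hi, ih, hupdate]
    rw [lintegral_const_mul _ ((hf i).mul_const _), lintegral_mul_const _ (hf i),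
      Finset.prod_insert hi]
    ring

variable [Fintype ι]

theorem lintegral_pi_prod (hf : ∀ i, Measurable (f i)) :
    ∫⁻ x, ∏ i, f i (x i) ∂Measure.pi μ = ∏ i, ∫⁻ t, f i t ∂μ i := by
  classical
  rcases isEmpty_or_nonempty (∀ i, α i) with hα | ⟨⟨x⟩⟩
  · obtain ⟨i, hi⟩ : ∃ i, IsEmpty (α i) := by simpa using hα
    rw [lintegral_of_isEmpty, Finset.prod_eq_zero (Finset.mem_univ i) (lintegral_of_isEmpty _ _)]
  · rw [lintegral_eq_lmarginal_univ x, lmarginal_prod hf]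
    simp

theorem pi_withDensity (hf : ∀ i, Measurable (f i)) [∀ i, SigmaFinite ((μ i).withDensity (f i))] :
    Measure.pi (fun i => (μ i).withDensity (f i)) =
      (Measure.pi μ).withDensity fun x => ∏ i, f i (x i) := by
  refine Measure.pi_eq fun s hs => ?_
  rw [withDensity_apply _ (MeasurableSet.univ_pi hs), Measure.restrict_pi_pi, lintegral_pi_prod hf]
  exact Finset.prod_congr rfl fun i _ => (withDensity_apply _ (hs i)).symm

end ProductMeasures

theorem ext_of_Iic_pi {ι : Type*} [Finite ι] (κ κ' : Measure (ι → ℝ)) [IsFiniteMeasure κ]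
    (h : ∀ u, κ (Set.Iic u) = κ' (Set.Iic u)) : κ = κ' := by
  have hspan : IsCountablySpanning (Set.range (Set.Iic : ℝ → Set ℝ)) := by
    refine ⟨fun n : ℕ => Set.Iic (n : ℝ), fun n => ⟨_, rfl⟩, Set.iUnion_eq_univ_iff.2 fun t => ?_⟩
    exact exists_nat_ge t
  have hgen : MeasurableSpace.pi = MeasurableSpace.generateFrom
      (Set.univ.pi '' Set.univ.pi fun _ : ι => Set.range (Set.Iic : ℝ → Set ℝ)) := by
    refine (generateFrom_eq_pi (fun _ => ?_) fun _ => hspan).symm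
    rw [← borel_eq_generateFrom_Iic, BorelSpace.measurable_eq (α := ℝ)]
  refine Measure.ext_of_generateFrom_of_iUnion _ (fun n : ℕ => Set.Iic fun _ => (n : ℝ)) hgen
    (IsPiSystem.pi fun _ => isPiSystem_Iic) ?_ (fun n => ⟨fun _ => Set.Iic (n : ℝ), ?_⟩)
    (fun _ => measure_ne_top κ _) ?_
  · refine Set.iUnion_eq_univ_iff.2 fun u => ?_
    obtain ⟨b, hb⟩ := (Set.finite_range u).bddAbove
    obtain ⟨n, hn⟩ := exists_nat_ge b
    exact ⟨n, fun j => (hb ⟨j, rfl⟩).trans hn⟩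
  · exact ⟨fun _ _ => ⟨n, rfl⟩, Set.pi_univ_Iic _⟩
  · rintro _ ⟨s, hs, rfl⟩
    choose u hu using fun i => hs i (Set.mem_univ i)
    obtain rfl : (fun i => Set.Iic (u i)) = s := funext hu
    rw [Set.pi_univ_Iic]
    exact h u

theorem withDensity_map {α β : Type*} [MeasurableSpace α] [MeasurableSpace β] (ν : Measure α)
    {g : α → β} (hg : Measurable g) {f : β → ℝ≥0∞} (hf : Measurable f) :
    (ν.map g).withDensity f = (ν.withDensity fun a => f (g a)).map g := by
  ext s hs
  rw [withDensity_apply _ hs, Measure.map_apply hg hs, withDensity_apply _ (hg hs),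
    setLIntegral_map hs hf hg]

section Disintegration

variable {A B B' : Type*} [MeasurableSpace A] [MeasurableSpace B] [MeasurableSpace B']
  {η : Measure A} {ρ : Measure B} {D : A × B → ℝ≥0∞}

theorem withDensity_compProd [SFinite η] {κ : Kernel A B} [IsSFiniteKernel κ] {L : A → ℝ≥0∞}
    (hL : Measurable L) :
    (η.withDensity L) ⊗ₘ κ = (η ⊗ₘ κ).withDensity fun p => L p.1 := by
  ext s hs
  rw [Measure.compProd_apply hs, lintegral_withDensity_eq_lintegral_mul _ hL
      (Kernel.measurable_kernel_prodMk_left hs), withDensity_apply _ hs, ← lintegral_indicator hs,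
    Measure.lintegral_compProd (Measurable.indicator (by fun_prop) hs)]
  refine lintegral_congr fun x => ?_
  have hsx : MeasurableSet (Prod.mk x ⁻¹' s) := measurable_prodMk_left hs
  calc L x * κ x (Prod.mk x ⁻¹' s) = ∫⁻ v, (Prod.mk x ⁻¹' s).indicator (fun _ => L x) v ∂κ x :=
        (lintegral_indicator_const hsx _).symm
    _ = ∫⁻ v, s.indicator (fun p => L p.1) (x, v) ∂κ x := rfl

variable (ρ D) in
/-- The density at `x` of the first marginal of the measure with density `D` with respect to a
product measure with second factor `ρ`. -/
def fstDensity (x : A) : ℝ≥0∞ := ∫⁻ v, D (x, v) ∂ρ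

theorem measurable_fstDensity [SFinite ρ] (hD : Measurable D) : Measurable (fstDensity ρ D) :=
  hD.lintegral_prod_right'

theorem map_fst_withDensity_prod [SFinite η] [SFinite ρ] (hD : Measurable D) :
    ((η.prod ρ).withDensity D).map Prod.fst = η.withDensity (fstDensity ρ D) := by
  ext s hs
  rw [Measure.map_apply measurable_fst hs, withDensity_apply _ (measurable_fst hs),
    ← Set.prod_univ, setLIntegral_prod _ hD.aemeasurable, withDensity_apply _ hs]
  simp only [Measure.restrict_univ, fstDensity]

theorem ae_fstDensity_ne_top [SFinite ρ] (hD : Measurable D)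
    [IsFiniteMeasure (η.withDensity (fstDensity ρ D))] : ∀ᵐ x ∂η, fstDensity ρ D x ≠ ∞ := by
  refine (ae_lt_top (measurable_fstDensity hD) ?_).mono fun x hx => hx.ne
  rw [← setLIntegral_univ, ← withDensity_apply _ MeasurableSet.univ]
  exact measure_ne_top _ _

theorem ae_withDensity_fstDensity_ne_zero [SFinite ρ] (hD : Measurable D) :
    ∀ᵐ x ∂η.withDensity (fstDensity ρ D), fstDensity ρ D x ≠ 0 :=
  (ae_withDensity_iff (measurable_fstDensity hD)).2 (.of_forall fun _ => id)

theorem ae_prod_eq_zero_of_fstDensity_eq_zero [SFinite ρ] (hD : Measurable D) :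
    ∀ᵐ p ∂η.prod ρ, fstDensity ρ D p.1 = 0 → D p = 0 := by
  have hL := measurable_fstDensity (ρ := ρ) hD
  refine (Measure.ae_prod_iff_ae_ae ?_).2 (Filter.Eventually.of_forall fun x => ?_)
  · exact ((hL.comp measurable_fst) (measurableSet_singleton 0)).imp
      (hD (measurableSet_singleton 0))
  · by_cases hx : fstDensity ρ D x = 0
    · filter_upwards [(lintegral_eq_zero_iff (hD.comp measurable_prodMk_left)).1 hx] with v hv _
        using hv
    · exact Filter.Eventually.of_forall fun v h => absurd h hx

variable (ρ D) in
/-- The conditional law of the second variable given the first one under the measure with density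
`D` with respect to a product measure with second factor `ρ`: the normalization of `D (x, ·)`.
Since `∞ * 0 = 0`, it vanishes at the points `x` at which `fstDensity` does. -/
def sndKernel [SFinite ρ] : Kernel A B :=
  (Kernel.const A ρ).withDensity fun x v => (fstDensity ρ D x)⁻¹ * D (x, v)

theorem measurable_sndKernel_density [SFinite ρ] (hD : Measurable D) :
    Measurable (Function.uncurry fun x v => (fstDensity ρ D x)⁻¹ * D (x, v)) :=
  ((measurable_fstDensity hD).comp measurable_fst).inv.mul hD

theorem sndKernel_apply [SFinite ρ] (hD : Measurable D) (x : A) :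
    sndKernel ρ D x = ρ.withDensity fun v => (fstDensity ρ D x)⁻¹ * D (x, v) := by
  rw [sndKernel, Kernel.withDensity_apply _ (measurable_sndKernel_density hD), Kernel.const_apply]

theorem isFiniteKernel_sndKernel [SFinite ρ] (hD : Measurable D) :
    IsFiniteKernel (sndKernel ρ D) := by
  refine ⟨⟨1, ENNReal.one_lt_top, fun x => ?_⟩⟩
  have hDx : Measurable fun v => D (x, v) := hD.comp measurable_prodMk_left
  rw [sndKernel_apply hD, withDensity_apply _ MeasurableSet.univ, Measure.restrict_univ,
    lintegral_const_mul _ hDx]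
  exact ENNReal.inv_mul_le_one _

theorem withDensity_fstDensity_compProd_sndKernel [SFinite η] [SFinite ρ] (hD : Measurable D)
    [IsFiniteMeasure (η.withDensity (fstDensity ρ D))] :
    (η.withDensity (fstDensity ρ D)) ⊗ₘ sndKernel ρ D = (η.prod ρ).withDensity D := by
  have hL := measurable_fstDensity (ρ := ρ) hD
  have hG := measurable_sndKernel_density (ρ := ρ) hD
  have hN : IsFiniteKernel ((Kernel.const A ρ).withDensity
      fun x v => (fstDensity ρ D x)⁻¹ * D (x, v)) := isFiniteKernel_sndKernel hD
  have hLG : ∀ᵐ p ∂η.prod ρ, (fstDensity ρ D p.1)⁻¹ * D p * fstDensity ρ D p.1 = D p := by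
    filter_upwards [Measure.quasiMeasurePreserving_fst.ae (ae_fstDensity_ne_top (ρ := ρ) hD),
      ae_prod_eq_zero_of_fstDensity_eq_zero hD] with p htop hzero
    rcases eq_or_ne (fstDensity ρ D p.1) 0 with h0 | h0
    · simp only [hzero h0, mul_zero, zero_mul]
    · rw [mul_right_comm, ENNReal.inv_mul_cancel h0 htop, one_mul]
  rw [sndKernel, withDensity_compProd hL, Measure.compProd_withDensity hG, Measure.compProd_const]
  exact (withDensity_mul _ hG (hL.comp measurable_fst)).symm.trans (withDensity_congr_ae hLG)

theorem map_compProd_eq_compProd_map {ν : Measure A} [SFinite ν] {N : Kernel A B}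
    [IsSFiniteKernel N] {w : A × B → B'} (hw : Measurable w) :
    (ν ⊗ₘ N).map (fun p => (p.1, w p)) = ν ⊗ₘ (Kernel.id ×ₖ N).map w := by
  have hwm : Measurable fun p : A × B => (p.1, w p) := measurable_fst.prodMk hw
  ext s hs
  rw [Measure.map_apply hwm hs, Measure.compProd_apply (hwm hs), Measure.compProd_apply hs]
  refine lintegral_congr fun x => ?_
  have hsx : MeasurableSet (Prod.mk x ⁻¹' s) := measurable_prodMk_left hs
  rw [Kernel.map_apply' _ hw _ hsx, Kernel.prod_apply, Kernel.id_apply, Measure.dirac_prod,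
    Measure.map_apply measurable_prodMk_left (hw hsx)]
  rfl

variable {Ω : Type*} [MeasurableSpace Ω] [SFinite η] [SFinite ρ] {P : Measure Ω} {X : Ω → A}
  {U : Ω → B'} {w : A × B → B'}

theorem map_eq_withDensity_fstDensity (hX : AEMeasurable X P) (hU : AEMeasurable U P)
    (hD : Measurable D) (hw : Measurable w)
    (h : P.map (fun ω => (X ω, U ω)) = ((η.prod ρ).withDensity D).map fun p => (p.1, w p)) :
    P.map X = η.withDensity (fstDensity ρ D) := by
  calc P.map X = (P.map fun ω => (X ω, U ω)).map Prod.fst :=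
        (AEMeasurable.map_map_of_aemeasurable measurable_fst.aemeasurable (hX.prodMk hU)).symm
    _ = ((η.prod ρ).withDensity D).map Prod.fst := by
        rw [h, Measure.map_map measurable_fst (measurable_fst.prodMk hw)]; rfl
    _ = η.withDensity (fstDensity ρ D) := map_fst_withDensity_prod hD

theorem condDistrib_ae_eq_map_sndKernel [StandardBorelSpace B'] [Nonempty B'] [IsFiniteMeasure P]
    (hX : AEMeasurable X P) (hU : AEMeasurable U P) (hD : Measurable D) (hw : Measurable w)
    (h : P.map (fun ω => (X ω, U ω)) = ((η.prod ρ).withDensity D).map fun p => (p.1, w p)) :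
    ∀ᵐ x ∂P.map X, condDistrib U X P x = (sndKernel ρ D x).map fun v => w (x, v) := by
  have hfst := map_eq_withDensity_fstDensity hX hU hD hw h
  have : IsFiniteMeasure (η.withDensity (fstDensity ρ D)) := hfst ▸ inferInstance
  have := isFiniteKernel_sndKernel (ρ := ρ) hD
  have hcomp : P.map (fun ω => (X ω, U ω)) =
      P.map X ⊗ₘ (Kernel.id ×ₖ sndKernel ρ D).map w := by
    rw [h, ← withDensity_fstDensity_compProd_sndKernel hD, ← hfst, map_compProd_eq_compProd_map hw]
  filter_upwards [condDistrib_ae_eq_of_measure_eq_compProd X hU hcomp] with x hx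
  rw [hx, Kernel.map_apply _ hw, Kernel.prod_apply, Kernel.id_apply, Measure.dirac_prod,
    Measure.map_map hw measurable_prodMk_left]
  rfl

end Disintegration

section Quantile

variable (μ : Measure ℝ)

/-- Lebesgue measure on `[0,1]`. -/
abbrev unifMeasure : Measure ℝ := (volume : Measure ℝ).restrict (Set.Icc 0 1)

instance isProbabilityMeasure_unifMeasure : IsProbabilityMeasure unifMeasure :=
  ⟨by simp [unifMeasure]⟩

theorem ae_unifMeasure_Ioo : ∀ᵐ u ∂unifMeasure, u ∈ Set.Ioo (0 : ℝ) 1 := by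
  rw [unifMeasure, ← restrict_Ioo_eq_restrict_Icc]
  exact ae_restrict_mem measurableSet_Ioo

theorem ae_unifMeasure_notMem_of_countable {s : Set ℝ} (hs : s.Countable) :
    ∀ᵐ u ∂unifMeasure, u ∉ s :=
  ae_restrict_of_ae (hs.ae_notMem _)

theorem jumps_countable : (jumps μ).Countable :=
  (monotone_cdf μ).countable_not_continuousAt

theorem measurableSet_jumps : MeasurableSet (jumps μ) := (jumps_countable μ).measurableSet

theorem ae_notMem_jumps : ∀ᵐ t ∂(volume : Measure ℝ), t ∉ jumps μ :=
  (jumps_countable μ).ae_notMem _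

theorem ae_mem_jumps : ∀ᵐ t ∂(Measure.count : Measure ℝ).restrict (jumps μ), t ∈ jumps μ :=
  ae_restrict_mem (measurableSet_jumps μ)

theorem measurable_cdf : Measurable (cdf μ) := (monotone_cdf μ).measurable

theorem measurable_leftLim_cdf : Measurable (Function.leftLim (cdf μ)) :=
  (monotone_cdf μ).leftLim.measurable

theorem leftLim_cdf_nonneg (t : ℝ) : 0 ≤ Function.leftLim (cdf μ) t :=
  (cdf_nonneg μ (t - 1)).trans ((monotone_cdf μ).le_leftLim (by linarith))

theorem leftLim_cdf_le (t : ℝ) : Function.leftLim (cdf μ) t ≤ cdf μ t :=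
  (monotone_cdf μ).leftLim_le le_rfl

theorem leftLim_cdf_eq_of_notMem_jumps {t : ℝ} (ht : t ∉ jumps μ) :
    Function.leftLim (cdf μ) t = cdf μ t := by
  have hc : ContinuousAt (cdf μ) t := not_not.1 ht
  exact hc.continuousWithinAt.leftLim_eq

theorem Ico_leftLim_cdf_subset_Icc (t : ℝ) :
    Set.Ico (Function.leftLim (cdf μ) t) (cdf μ t) ⊆ Set.Icc 0 1 := fun _ hu =>
  ⟨(leftLim_cdf_nonneg μ t).trans hu.1, hu.2.le.trans (cdf_le_one μ t)⟩

theorem quantile_le_iff {u : ℝ} (hu : u ∈ Set.Ioo (0 : ℝ) 1) {t : ℝ} :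
    quantile μ u ≤ t ↔ u ≤ cdf μ t := by
  have hbdd : BddBelow {t : ℝ | u ≤ cdf μ t} := by
    have := (tendsto_cdf_atBot μ).eventually (gt_mem_nhds hu.1)
    obtain ⟨s, hs⟩ := this.exists
    refine ⟨s, fun t ht => ?_⟩
    by_contra! h
    exact absurd (ht.trans (monotone_cdf μ h.le)) (not_le.2 hs)
  have hne : {t : ℝ | u ≤ cdf μ t}.Nonempty := by
    have := (tendsto_cdf_atTop μ).eventually (lt_mem_nhds hu.2)
    obtain ⟨s, hs⟩ := this.exists
    exact ⟨s, hs.le⟩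
  constructor
  · intro h
    have hr : Filter.Tendsto (cdf μ) (nhdsWithin t (Set.Ioi t)) (nhds (cdf μ t)) :=
      ((cdf μ).right_continuous t).mono Set.Ioi_subset_Ici_self
    refine ge_of_tendsto hr ?_
    filter_upwards [self_mem_nhdsWithin] with s hs
    obtain ⟨r, hr, hrs⟩ := exists_lt_of_csInf_lt hne (lt_of_le_of_lt h hs)
    exact le_trans hr (monotone_cdf μ hrs.le)
  · intro h
    exact csInf_le hbdd h

theorem monotoneOn_quantile : MonotoneOn (quantile μ) (Set.Ioo 0 1) := fun _ hu _ hv huv =>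
  (quantile_le_iff μ hu).2 (huv.trans ((quantile_le_iff μ hv).1 le_rfl))

theorem quantile_of_nonpos {u : ℝ} (hu : u ≤ 0) : quantile μ u = 0 := by
  have huniv : {t : ℝ | u ≤ cdf μ t} = Set.univ :=
    Set.eq_univ_of_forall fun t => hu.trans (cdf_nonneg μ t)
  rw [quantile, huniv, Real.sInf_univ]

theorem quantile_of_one_lt {u : ℝ} (hu : 1 < u) : quantile μ u = 0 := by
  have hempty : {t : ℝ | u ≤ cdf μ t} = ∅ :=
    Set.eq_empty_of_forall_notMem fun t ht => (hu.trans_le ht).not_ge (cdf_le_one μ t)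
  rw [quantile, hempty, Real.sInf_empty]

theorem measurable_quantile : Measurable (quantile μ) := by
  have hindicator : Measurable ((Set.Ioo (0 : ℝ) 1).indicator (quantile μ)) := by
    have hmeas : Measurable fun u : Set.Ioo (0 : ℝ) 1 => quantile μ u :=
      Monotone.measurable fun u v huv => monotoneOn_quantile μ u.2 v.2 huv
    refine measurable_of_restrict_of_restrict_compl (s := Set.Ioo 0 1) measurableSet_Ioo ?_ ?_
    · convert hmeas using 2 with u
      exact Set.indicator_of_mem u.2 _
    · convert! measurable_const (a := (0 : ℝ)) using 2 with u
      exact Set.indicator_of_notMem u.2 _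
  refine hindicator.measurable_of_countable_ne ((Set.countable_singleton 1).mono fun u hu => ?_)
  by_contra hu1
  refine hu (Set.indicator_apply_eq_self.2 fun hu01 => ?_)
  rcases le_or_gt u 0 with h0 | h0
  · exact quantile_of_nonpos μ h0
  · exact quantile_of_one_lt μ (lt_of_le_of_ne' (not_lt.1 fun h1 => hu01 ⟨h0, h1⟩) hu1)

theorem map_quantile_unifMeasure [IsProbabilityMeasure μ] : unifMeasure.map (quantile μ) = μ := by
  refine Measure.ext_of_Iic _ _ fun t => ?_
  rw [Measure.map_apply (measurable_quantile μ) measurableSet_Iic, ← ofReal_cdf]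
  have hpre : quantile μ ⁻¹' Set.Iic t =ᵐ[unifMeasure] Set.Iic (cdf μ t) := by
    filter_upwards [ae_unifMeasure_Ioo] with u hu
    exact propext (quantile_le_iff μ hu)
  rw [measure_congr hpre, unifMeasure, Measure.restrict_apply measurableSet_Iic]
  have hIcc : Set.Iic (cdf μ t) ∩ Set.Icc 0 1 = Set.Icc 0 (cdf μ t) := by
    ext u; simp only [Set.mem_inter_iff, Set.mem_Iic, Set.mem_Icc]
    constructor
    · rintro ⟨h, h0, _⟩; exact ⟨h0, h⟩
    · rintro ⟨h0, h⟩; exact ⟨h, h0, h.trans (cdf_le_one μ t)⟩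
  rw [hIcc, Real.volume_Icc, sub_zero]

theorem le_cdf_quantile {u : ℝ} (hu : u ∈ Set.Ioo (0 : ℝ) 1) : u ≤ cdf μ (quantile μ u) :=
  (quantile_le_iff μ hu).1 le_rfl

theorem leftLim_cdf_quantile_le {u : ℝ} (hu : u ∈ Set.Ioo (0 : ℝ) 1) :
    Function.leftLim (cdf μ) (quantile μ u) ≤ u := by
  refine le_of_tendsto ((monotone_cdf μ).tendsto_leftLim (quantile μ u)) ?_
  filter_upwards [self_mem_nhdsWithin] with s hs
  by_contra! h
  exact absurd ((quantile_le_iff μ hu).2 h.le) (not_le.2 hs)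

theorem quantile_eq_of_mem_Ioo {t u : ℝ} (hu : u ∈ Set.Ioo (Function.leftLim (cdf μ) t) (cdf μ t)) :
    quantile μ u = t := by
  have hu' : u ∈ Set.Ioo (0 : ℝ) 1 :=
    ⟨(leftLim_cdf_nonneg μ t).trans_lt hu.1, hu.2.trans_le (cdf_le_one μ t)⟩
  refine le_antisymm ((quantile_le_iff μ hu').2 hu.2.le) ?_
  by_contra! h
  have h1 := le_cdf_quantile μ hu'
  have h2 := (monotone_cdf μ).le_leftLim h
  linarith [hu.1]

/-- The relation between a point `t` and a level `u` that holds for `t = F⁻¹(u)`. -/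
def IsMatched (t u : ℝ) : Prop :=
  (t ∉ jumps μ → u = cdf μ t) ∧
    (t ∈ jumps μ → u ∈ Set.Ico (Function.leftLim (cdf μ) t) (cdf μ t))

/-- The pairs `(t, u)` with `F(t⁻) ≤ u < F(t)`. -/
def jumpBox : Set (ℝ × ℝ) :=
  {p | p.2 ∈ Set.Ico (Function.leftLim (cdf μ) p.1) (cdf μ p.1)}

theorem measurableSet_jumpBox : MeasurableSet (jumpBox μ) :=
  (measurableSet_le ((measurable_leftLim_cdf μ).comp measurable_fst) measurable_snd).inter
    (measurableSet_lt measurable_snd ((measurable_cdf μ).comp measurable_fst))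

theorem measurableSet_isMatched : MeasurableSet {p : ℝ × ℝ | IsMatched μ p.1 p.2} := by
  have hJ : MeasurableSet {p : ℝ × ℝ | p.1 ∈ jumps μ} := measurable_fst (measurableSet_jumps μ)
  have hF : MeasurableSet {p : ℝ × ℝ | p.2 = cdf μ p.1} :=
    measurableSet_eq_fun measurable_snd ((measurable_cdf μ).comp measurable_fst)
  exact (hJ.compl.imp hF).inter (hJ.imp (measurableSet_jumpBox μ))

theorem ae_isMatched_quantile : ∀ᵐ u ∂unifMeasure, IsMatched μ (quantile μ u) u := by
  filter_upwards [ae_unifMeasure_Ioo, ae_unifMeasure_notMem_of_countable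
    ((jumps_countable μ).image (cdf μ))] with u hu hn
  refine ⟨fun h => le_antisymm (le_cdf_quantile μ hu) ?_,
    fun h => ⟨leftLim_cdf_quantile_le μ hu, ?_⟩⟩
  · rw [← leftLim_cdf_eq_of_notMem_jumps μ h]; exact leftLim_cdf_quantile_le μ hu
  · exact lt_of_le_of_ne (le_cdf_quantile μ hu) fun h' => hn ⟨_, h, h'.symm⟩

theorem ae_eq_quantile_of_eq_cdf :
    ∀ᵐ u ∂unifMeasure, ∀ t, u = cdf μ t → t = quantile μ u := by
  filter_upwards [ae_unifMeasure_Ioo, ae_unifMeasure_notMem_of_countable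
    ((Set.countable_range ((↑) : ℚ → ℝ)).image (cdf μ))] with u hu hn t ht
  have h1 : quantile μ u ≤ t := (quantile_le_iff μ hu).2 ht.le
  refine le_antisymm ?_ h1
  by_contra! h
  obtain ⟨q, hq, hqt⟩ := exists_rat_btwn h
  refine hn ⟨q, ⟨q, rfl⟩, le_antisymm ?_ ?_⟩
  · rw [ht]; exact monotone_cdf μ hqt.le
  · exact (le_cdf_quantile μ hu).trans (monotone_cdf μ hq.le)

end Quantile

section QuantileCoupling

variable (μ : Measure ℝ)

/-- The measure `dt + δ_J(dt)` for a single coordinate. -/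
abbrev lebCount : Measure ℝ := (volume : Measure ℝ) + Measure.count.restrict (jumps μ)

instance sigmaFinite_count_restrict_jumps :
    SigmaFinite ((Measure.count : Measure ℝ).restrict (jumps μ)) := by
  have := (jumps_countable μ).to_subtype
  have h : (Measure.count : Measure ℝ).restrict (jumps μ)
      = (Measure.count : Measure (jumps μ)).map (↑) := by
    ext s hs
    rw [Measure.restrict_apply hs, Measure.map_apply measurable_subtype_coe hs,
      ← Measure.count_injective_image Subtype.val_injective, Subtype.image_preimage_coe,
      Set.inter_comm]
  rw [h]
  exact (MeasurableEmbedding.subtype_coe (measurableSet_jumps μ)).sigmaFinite_map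

theorem ae_prod_mem_jumps (ν : Measure ℝ) :
    ∀ᵐ p ∂((Measure.count : Measure ℝ).restrict (jumps μ)).prod ν, p.1 ∈ jumps μ :=
  Measure.quasiMeasurePreserving_fst.ae (ae_mem_jumps μ)

theorem measurable_prodMk_cdf : Measurable fun t => (t, cdf μ t) :=
  measurable_id.prodMk (measurable_cdf μ)

theorem measure_singleton_eq_ofReal_cdf_sub_leftLim [IsProbabilityMeasure μ] (t : ℝ) :
    μ {t} = ENNReal.ofReal (cdf μ t - Function.leftLim (cdf μ) t) := by
  conv_lhs => rw [← measure_cdf μ]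
  exact StieltjesFunction.measure_singleton _ _

theorem measure_eq_zero_of_countable_of_disjoint_jumps [IsProbabilityMeasure μ] {s : Set ℝ}
    (hs : s.Countable) (hJ : Disjoint s (jumps μ)) : μ s = 0 := by
  rw [← Set.biUnion_of_singleton s, measure_biUnion_null_iff hs]
  intro t ht
  rw [measure_singleton_eq_ofReal_cdf_sub_leftLim,
    leftLim_cdf_eq_of_notMem_jumps μ (hJ.notMem_of_mem_left ht), sub_self, ENNReal.ofReal_zero]

variable {μ} {f : ℝ → ℝ}

theorem IsMixedMarginal.restrict_compl_jumps [IsProbabilityMeasure μ] (h : IsMixedMarginal μ f) :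
    μ.restrict (jumps μ)ᶜ = (volume : Measure ℝ).withDensity fun t => ENNReal.ofReal (f t) := by
  obtain ⟨ν, T, hT, hνT, hμ⟩ := h.decomp
  have hac : ((volume : Measure ℝ).withDensity fun t => ENNReal.ofReal (f t)).restrict (jumps μ)ᶜ
      = (volume : Measure ℝ).withDensity fun t => ENNReal.ofReal (f t) :=
    Measure.restrict_eq_self_of_ae_mem
      ((withDensity_absolutelyContinuous _ _).ae_le (ae_notMem_jumps μ))
  have hν : ν.restrict (jumps μ)ᶜ = 0 := by
    have hνμ : ν ≤ μ := hμ.symm ▸ Measure.le_add_left le_rfl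
    have hTJ : ν (T \ jumps μ) = 0 := Measure.absolutelyContinuous_of_le hνμ
      (measure_eq_zero_of_countable_of_disjoint_jumps μ (hT.mono Set.sdiff_subset)
        Set.disjoint_sdiff_left)
    rw [Measure.restrict_eq_zero]
    refine measure_mono_null (t := Tᶜ ∪ (T \ jumps μ)) (fun t ht => ?_) (measure_union_null hνT hTJ)
    exact (em (t ∈ T)).symm.imp id fun htT => ⟨htT, ht⟩
  calc μ.restrict (jumps μ)ᶜ = ((volume : Measure ℝ).withDensity
        fun t => ENNReal.ofReal (f t)).restrict (jumps μ)ᶜ + ν.restrict (jumps μ)ᶜ := by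
        rw [← Measure.restrict_add, ← hμ]
    _ = (volume : Measure ℝ).withDensity fun t => ENNReal.ofReal (f t) := by
        rw [hac, hν, add_zero]

variable (μ) in
/-- The joint law of `(F⁻¹(u), u)` for `u` uniform on `[0,1]`. -/
def quantileCoupling : Measure (ℝ × ℝ) := unifMeasure.map fun u => (quantile μ u, u)

variable (μ) in
theorem measurable_quantile_prodMk : Measurable fun u => (quantile μ u, u) :=
  (measurable_quantile μ).prodMk measurable_id

instance isProbabilityMeasure_quantileCoupling : IsProbabilityMeasure (quantileCoupling μ) :=
  Measure.isProbabilityMeasure_map (measurable_quantile_prodMk μ).aemeasurable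

theorem quantileCoupling_restrict_compl_jumps [IsProbabilityMeasure μ] :
    (quantileCoupling μ).restrict (Prod.fst ⁻¹' (jumps μ)ᶜ) =
      (μ.restrict (jumps μ)ᶜ).map fun t => (t, cdf μ t) := by
  have hJ : MeasurableSet (jumps μ)ᶜ := (measurableSet_jumps μ).compl
  have hmatched : (fun u => (quantile μ u, u)) =ᵐ[unifMeasure.restrict (quantile μ ⁻¹' (jumps μ)ᶜ)]
      (fun t => (t, cdf μ t)) ∘ quantile μ := by
    filter_upwards [ae_restrict_of_ae (ae_isMatched_quantile μ),
      ae_restrict_mem (measurable_quantile μ hJ)] with u hu huJ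
    exact Prod.ext rfl (hu.1 huJ)
  calc (quantileCoupling μ).restrict (Prod.fst ⁻¹' (jumps μ)ᶜ)
      = (unifMeasure.restrict (quantile μ ⁻¹' (jumps μ)ᶜ)).map fun u => (quantile μ u, u) :=
        Measure.restrict_map (measurable_quantile_prodMk μ) (measurable_fst hJ)
    _ = ((unifMeasure.restrict (quantile μ ⁻¹' (jumps μ)ᶜ)).map (quantile μ)).map
          fun t => (t, cdf μ t) := by
        rw [Measure.map_congr hmatched,
          Measure.map_map (measurable_prodMk_cdf μ) (measurable_quantile μ)]
    _ = (μ.restrict (jumps μ)ᶜ).map fun t => (t, cdf μ t) := by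
        rw [← Measure.restrict_map (measurable_quantile μ) hJ, map_quantile_unifMeasure]

theorem ae_quantile_eq_iff {t : ℝ} (ht : t ∈ jumps μ) :
    ∀ᵐ u ∂unifMeasure, quantile μ u = t ↔ u ∈ Set.Ico (Function.leftLim (cdf μ) t) (cdf μ t) := by
  filter_upwards [ae_isMatched_quantile μ, ae_unifMeasure_notMem_of_countable
    (Set.countable_singleton (Function.leftLim (cdf μ) t))] with u hu hne
  constructor
  · rintro rfl
    exact hu.2 ht
  · exact fun h => quantile_eq_of_mem_Ioo μ ⟨lt_of_le_of_ne' h.1 hne, h.2⟩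

theorem unifMeasure_quantile_fiber_inter {t : ℝ} (ht : t ∈ jumps μ) (s : Set ℝ) :
    unifMeasure (quantile μ ⁻¹' {t} ∩ s) =
      volume (s ∩ Set.Ico (Function.leftLim (cdf μ) t) (cdf μ t)) := by
  have hae : (quantile μ ⁻¹' {t} ∩ s : Set ℝ) =ᵐ[unifMeasure]
      (s ∩ Set.Ico (Function.leftLim (cdf μ) t) (cdf μ t) : Set ℝ) := by
    filter_upwards [ae_quantile_eq_iff ht] with u hu
    exact propext ((and_congr_left' hu).trans and_comm)
  rw [measure_congr hae, Measure.restrict_eq_self]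
  exact Set.inter_subset_right.trans (Ico_leftLim_cdf_subset_Icc μ t)

theorem quantileCoupling_restrict_jumps :
    (quantileCoupling μ).restrict (Prod.fst ⁻¹' jumps μ) =
      ((Measure.count.restrict (jumps μ)).prod (volume : Measure ℝ)).restrict (jumpBox μ) := by
  have hQ := measurable_quantile μ
  ext s hs
  have hunion : (fun u => (quantile μ u, u)) ⁻¹' (s ∩ Prod.fst ⁻¹' jumps μ) =
      ⋃ t ∈ jumps μ, quantile μ ⁻¹' {t} ∩ Prod.mk t ⁻¹' s := by
    ext u
    simp only [Set.mem_preimage, Set.mem_inter_iff, Set.mem_iUnion, Set.mem_singleton_iff]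
    grind
  have hdisj : (jumps μ).PairwiseDisjoint fun t => quantile μ ⁻¹' {t} ∩ Prod.mk t ⁻¹' s :=
    fun t _ t' _ htt' => Set.disjoint_left.2 fun u hu hu' => htt' (hu.1.symm.trans hu'.1)
  calc (quantileCoupling μ).restrict (Prod.fst ⁻¹' jumps μ) s
      = unifMeasure (⋃ t ∈ jumps μ, quantile μ ⁻¹' {t} ∩ Prod.mk t ⁻¹' s) := by
        rw [Measure.restrict_apply hs, quantileCoupling, Measure.map_apply
          (measurable_quantile_prodMk μ) (hs.inter (measurable_fst (measurableSet_jumps μ))),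
          hunion]
    _ = ∑' t : jumps μ, unifMeasure (quantile μ ⁻¹' {(t : ℝ)} ∩ Prod.mk (t : ℝ) ⁻¹' s) :=
        measure_biUnion (jumps_countable μ) hdisj fun t _ =>
          (hQ (measurableSet_singleton t)).inter (measurable_prodMk_left hs)
    _ = ∑' t : jumps μ, volume (Prod.mk (t : ℝ) ⁻¹' (s ∩ jumpBox μ)) :=
        tsum_congr fun t => unifMeasure_quantile_fiber_inter t.2 _
    _ = ((Measure.count.restrict (jumps μ)).prod volume).restrict (jumpBox μ) s := by
        rw [Measure.restrict_apply hs, Measure.prod_apply (hs.inter (measurableSet_jumpBox μ)),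
          lintegral_countable _ (jumps_countable μ)]
        simp only [Measure.count_singleton, mul_one]

theorem IsMixedMarginal.quantileCoupling_eq_add [IsProbabilityMeasure μ]
    (h : IsMixedMarginal μ f) :
    quantileCoupling μ =
      ((volume : Measure ℝ).withDensity fun t => ENNReal.ofReal (f t)).map (fun t => (t, cdf μ t)) +
        ((Measure.count.restrict (jumps μ)).prod (volume : Measure ℝ)).restrict (jumpBox μ) := by
  rw [← h.restrict_compl_jumps, ← quantileCoupling_restrict_compl_jumps,
    ← quantileCoupling_restrict_jumps, add_comm]
  exact (Measure.restrict_add_restrict_compl (measurable_fst (measurableSet_jumps μ))).symm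

theorem IsMixedMarginal.quantileCoupling_eq_restrict_isMatched [IsProbabilityMeasure μ]
    (h : IsMixedMarginal μ f) :
    quantileCoupling μ =
      (((volume : Measure ℝ).withDensity fun t => ENNReal.ofReal (f t)).map
          (fun t => (t, cdf μ t)) +
        (Measure.count.restrict (jumps μ)).prod (volume : Measure ℝ)).restrict
          {p | IsMatched μ p.1 p.2} := by
  rw [h.quantileCoupling_eq_add, Measure.restrict_add]
  congr 1
  · refine (Measure.restrict_eq_self_of_ae_mem ?_).symm
    refine (ae_map_iff (measurable_prodMk_cdf μ).aemeasurable (measurableSet_isMatched μ)).2 ?_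
    refine (withDensity_absolutelyContinuous _ _).ae_le ?_
    filter_upwards [ae_notMem_jumps μ] with t ht using ⟨fun _ => rfl, fun h => absurd h ht⟩
  · refine Measure.restrict_congr_set ?_
    filter_upwards [ae_prod_mem_jumps μ volume] with p hp
    exact propext ⟨fun h => ⟨fun h' => absurd hp h', fun _ => h⟩, fun h => h.2 hp⟩

open Classical in
variable (μ) in
/-- The level paired with `t` in the coupling of `F⁻¹(u)` and `u`: it is `F(t)` if `F` is
continuous at `t`, and the free variable `v` otherwise. -/
def latentLevel (t v : ℝ) : ℝ := if t ∈ jumps μ then v else cdf μ t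

open Classical in
variable (μ f) in
/-- The density, with respect to `lebCount μ ⊗ unifMeasure`, of the coupling of `F⁻¹(u)` and `u` in
the coordinates `(t, v)` in which the level is `latentLevel μ t v`. -/
def latentWeight (t v : ℝ) : ℝ≥0∞ :=
  if t ∈ jumps μ then (jumpBox μ).indicator 1 (t, v) else ENNReal.ofReal (f t)

theorem measurable_latentLevel : Measurable fun p : ℝ × ℝ => latentLevel μ p.1 p.2 :=
  Measurable.ite (measurable_fst (measurableSet_jumps μ)) measurable_snd
    ((measurable_cdf μ).comp measurable_fst)

theorem measurable_latentWeight (hf : Measurable f) :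
    Measurable fun p : ℝ × ℝ => latentWeight μ f p.1 p.2 :=
  Measurable.ite (measurable_fst (measurableSet_jumps μ))
    (measurable_one.indicator (measurableSet_jumpBox μ)) (hf.comp measurable_fst).ennreal_ofReal

variable (μ) in
theorem measurable_prodMk_latentLevel :
    Measurable fun p : ℝ × ℝ => (p.1, latentLevel μ p.1 p.2) :=
  measurable_fst.prodMk measurable_latentLevel

theorem map_latentLevel_withDensity_volume_prod (hf : Measurable f) :
    (((volume : Measure ℝ).prod unifMeasure).withDensity
        fun p => latentWeight μ f p.1 p.2).map (fun p => (p.1, latentLevel μ p.1 p.2)) =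
      ((volume : Measure ℝ).withDensity fun t => ENNReal.ofReal (f t)).map
        fun t => (t, cdf μ t) := by
  have hcont : ∀ᵐ p ∂(volume : Measure ℝ).prod unifMeasure, p.1 ∉ jumps μ :=
    Measure.quasiMeasurePreserving_fst.ae (ae_notMem_jumps μ)
  have hweight : ((volume : Measure ℝ).prod unifMeasure).withDensity
        (fun p => latentWeight μ f p.1 p.2) =
      ((volume : Measure ℝ).withDensity fun t => ENNReal.ofReal (f t)).prod unifMeasure := by
    rw [prod_withDensity_left hf.ennreal_ofReal]
    exact withDensity_congr_ae (hcont.mono fun p hp => if_neg hp)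
  have hlevel : (fun p : ℝ × ℝ => (p.1, latentLevel μ p.1 p.2)) =ᵐ[((volume : Measure ℝ).prod
      unifMeasure).withDensity fun p => latentWeight μ f p.1 p.2]
      (fun t => (t, cdf μ t)) ∘ Prod.fst :=
    (withDensity_absolutelyContinuous _ _).ae_le
      (hcont.mono fun p hp => Prod.ext rfl (if_neg hp))
  rw [Measure.map_congr hlevel, hweight, ← Measure.map_map (measurable_prodMk_cdf μ) measurable_fst,
    Measure.map_fst_prod, measure_univ, one_smul]

theorem map_latentLevel_withDensity_count_prod :
    (((Measure.count.restrict (jumps μ)).prod unifMeasure).withDensity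
        fun p => latentWeight μ f p.1 p.2).map (fun p => (p.1, latentLevel μ p.1 p.2)) =
      ((Measure.count.restrict (jumps μ)).prod (volume : Measure ℝ)).restrict (jumpBox μ) := by
  have hjump := ae_prod_mem_jumps μ unifMeasure
  have hweight : ((Measure.count.restrict (jumps μ)).prod unifMeasure).withDensity
        (fun p => latentWeight μ f p.1 p.2) =
      ((Measure.count.restrict (jumps μ)).prod unifMeasure).restrict (jumpBox μ) := by
    rw [← withDensity_indicator_one (measurableSet_jumpBox μ)]
    exact withDensity_congr_ae (hjump.mono fun p hp => if_pos hp)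
  have hlevel : (fun p : ℝ × ℝ => (p.1, latentLevel μ p.1 p.2)) =ᵐ[((Measure.count.restrict
      (jumps μ)).prod unifMeasure).withDensity fun p => latentWeight μ f p.1 p.2] id :=
    (withDensity_absolutelyContinuous _ _).ae_le
      (hjump.mono fun p hp => Prod.ext rfl (if_pos hp))
  have hunif : (Measure.count.restrict (jumps μ)).prod unifMeasure =
      ((Measure.count.restrict (jumps μ)).prod (volume : Measure ℝ)).restrict
        (Set.univ ×ˢ Set.Icc 0 1) := by
    rw [← Measure.prod_restrict, Measure.restrict_univ]
  rw [Measure.map_congr hlevel, Measure.map_id, hweight, hunif,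
    Measure.restrict_restrict (measurableSet_jumpBox μ), Set.inter_eq_left.2]
  exact fun p hp => ⟨Set.mem_univ _, Ico_leftLim_cdf_subset_Icc μ p.1 hp⟩

theorem IsMixedMarginal.quantileCoupling_eq_map_latentLevel [IsProbabilityMeasure μ]
    (h : IsMixedMarginal μ f) :
    quantileCoupling μ =
      (((lebCount μ).prod unifMeasure).withDensity fun p => latentWeight μ f p.1 p.2).map
        fun p => (p.1, latentLevel μ p.1 p.2) := by
  rw [lebCount, Measure.add_prod, withDensity_add_measure,
    Measure.map_add _ _ (measurable_prodMk_latentLevel μ),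
    map_latentLevel_withDensity_volume_prod h.measurable, map_latentLevel_withDensity_count_prod,
    ← h.quantileCoupling_eq_add]

end QuantileCoupling

section Copula

/-- Lebesgue measure on the unit cube `[0,1]^κ`. -/
abbrev cubeMeasure (κ : Type*) [Fintype κ] : Measure (κ → ℝ) :=
  (volume : Measure (κ → ℝ)).restrict (Set.Icc 0 1)

theorem cubeMeasure_eq_pi (κ : Type*) [Fintype κ] :
    cubeMeasure κ = Measure.pi fun _ => unifMeasure := by
  rw [cubeMeasure, ← Set.pi_univ_Icc, volume_pi, Measure.restrict_pi_pi]
  rfl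

instance isProbabilityMeasure_cubeMeasure (κ : Type*) [Fintype κ] :
    IsProbabilityMeasure (cubeMeasure κ) := by
  rw [cubeMeasure_eq_pi]
  infer_instance

variable {ι : Type*} {C c : (ι → ℝ) → ℝ} {κ : Measure (ι → ℝ)} [IsFiniteMeasure κ]

theorem IsCopula.ae_mem_Icc [Finite ι] (hC : IsCopula C) (hκ : ∀ u, κ.real (Set.Iic u) = C u) :
    ∀ᵐ u ∂κ, u ∈ Set.Icc (0 : ι → ℝ) 1 := by
  obtain ⟨κ', hprob, hmarg, hcdf⟩ := hC
  obtain rfl : κ = κ' := ext_of_Iic_pi _ _ fun u => by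
    rw [← ofReal_measureReal, ← ofReal_measureReal, hκ, hcdf]
  have hcoord : ∀ j, ∀ᵐ u ∂κ, u j ∈ Set.Icc (0 : ℝ) 1 := fun j => by
    have h : ∀ᵐ t ∂κ.map (fun u => u j), t ∈ Set.Icc (0 : ℝ) 1 := by
      rw [hmarg j]
      exact ae_restrict_mem measurableSet_Icc
    exact ae_of_ae_map (measurable_pi_apply j).aemeasurable h
  filter_upwards [ae_all_iff.2 hcoord] with u hu
  exact ⟨fun j => (hu j).1, fun j => (hu j).2⟩

variable [Fintype ι]

theorem ae_cubeMeasure_of_forall_ae {p : ι → ℝ → Prop} (h : ∀ j, ∀ᵐ t ∂unifMeasure, p j t) :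
    ∀ᵐ u ∂cubeMeasure ι, ∀ j, p j (u j) := by
  rw [cubeMeasure_eq_pi, ae_all_iff]
  exact fun j => (Measure.quasiMeasurePreserving_eval (fun _ : ι => unifMeasure) j).ae (h j)

theorem IsCopulaDensity.integral_eq_one (hc : IsCopulaDensity C c) (hC : IsCopula C) :
    ∫ u, c u ∂cubeMeasure ι = 1 := by
  have hC' := hC
  obtain ⟨κ, _, -, hcdf⟩ := hC
  have hIic : κ (Set.Iic 1) = 1 := (mem_ae_iff_prob_eq_one measurableSet_Iic).1 <|
    (hC'.ae_mem_Icc fun u => (hcdf u).symm).mono fun _ hu => hu.2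
  rw [← hc.eq_integral 1 ⟨zero_le_one, le_rfl⟩, hcdf, measureReal_def, hIic, ENNReal.toReal_one]

theorem IsCopulaDensity.integrable (hc : IsCopulaDensity C c) (hC : IsCopula C) :
    Integrable c (cubeMeasure ι) :=
  integrable_of_integral_eq_one (hc.integral_eq_one hC)

theorem IsCopulaDensity.eq_withDensity (hc : IsCopulaDensity C c) (hC : IsCopula C)
    (hκ : ∀ u, κ.real (Set.Iic u) = C u) :
    κ = (cubeMeasure ι).withDensity fun u => ENNReal.ofReal (c u) := by
  have hint := hc.integrable hC
  refine ext_of_Iic_pi _ _ fun u => ?_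
  have hIcc : ∀ v : ι → ℝ, Set.Iic v ∩ Set.Icc 0 1 = Set.Icc 0 (v ⊓ 1) := fun v => by
    rw [← Set.Ici_inter_Iic, ← Set.Ici_inter_Iic, ← Set.Iic_inter_Iic, Set.inter_left_comm]
  have hκIcc : ∀ v : ι → ℝ, κ (Set.Iic v) = κ (Set.Icc 0 (v ⊓ 1)) := fun v => by
    rw [← hIcc]
    exact measure_congr (inter_ae_eq_left_of_ae_eq_univ
      (Filter.eventuallyEq_univ.2 (hC.ae_mem_Icc hκ))).symm
  rw [withDensity_apply _ measurableSet_Iic, Measure.restrict_restrict measurableSet_Iic, hIcc]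
  by_cases hu : 0 ≤ u
  · calc κ (Set.Iic u) = κ (Set.Iic (u ⊓ 1)) := by rw [hκIcc, hκIcc, inf_assoc, inf_idem]
      _ = ENNReal.ofReal (∫ v in Set.Icc 0 (u ⊓ 1), c v) := by
        rw [← ofReal_measureReal, hκ, hc.eq_integral _ ⟨le_inf hu zero_le_one, inf_le_right⟩]
      _ = ∫⁻ v in Set.Icc 0 (u ⊓ 1), ENNReal.ofReal (c v) :=
        ofReal_integral_eq_lintegral_ofReal
          (hint.mono_measure (Measure.restrict_mono (Set.Icc_subset_Icc_right inf_le_right) le_rfl))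
          (Filter.Eventually.of_forall hc.nonneg)
  · have hempty : Set.Icc (0 : ι → ℝ) (u ⊓ 1) = ∅ :=
      Set.Icc_eq_empty fun h => hu (h.trans inf_le_left)
    simp only [hκIcc, hempty, measure_empty, Measure.restrict_empty, lintegral_zero_measure]

end Copula

section JointLaw

variable {ι : Type*} {c : (ι → ℝ) → ℝ} {μ : ι → Measure ℝ} {f : ι → ℝ → ℝ}

variable (μ) in
/-- The pairs `(x, u)` in which every `u_j` is a level matched to `x_j`: the support of the joint
density. -/
def matchedSet : Set ((ι → ℝ) × (ι → ℝ)) := {p | ∀ j, IsMatched (μ j) (p.1 j) (p.2 j)}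

variable (μ) in
theorem measurable_quantiles_prodMk :
    Measurable fun u : ι → ℝ => ((fun j => quantile (μ j) (u j) : ι → ℝ), u) :=
  (measurable_pi_lambda _ fun j =>
    (measurable_quantile (μ j)).comp (measurable_pi_apply j)).prodMk measurable_id

theorem measurable_eval_prodMk (j : ι) :
    Measurable fun p : (ι → ℝ) × (ι → ℝ) => (p.1 j, p.2 j) := by
  fun_prop

theorem measurable_unzip :
    Measurable fun p : ι → ℝ × ℝ => ((fun j => (p j).1 : ι → ℝ), (fun j => (p j).2 : ι → ℝ)) := by
  fun_prop

/-- The vector of levels `latentLevel (μ j) (x j) (u j)` in the multivariate coupling. -/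
def latentLevels (μ : ι → Measure ℝ) (x u : ι → ℝ) : ι → ℝ :=
  fun j => latentLevel (μ j) (x j) (u j)

variable (μ) in
theorem measurable_latentLevels :
    Measurable fun p : (ι → ℝ) × (ι → ℝ) => latentLevels μ p.1 p.2 :=
  measurable_pi_lambda _ fun j => measurable_latentLevel.comp (measurable_eval_prodMk j)

variable (μ) in
theorem measurable_prodMk_latentLevels :
    Measurable fun p : (ι → ℝ) × (ι → ℝ) => (p.1, latentLevels μ p.1 p.2) :=
  measurable_fst.prodMk (measurable_latentLevels μ)

theorem measurableSet_matchedSet [Finite ι] : MeasurableSet (matchedSet μ) := by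
  simp only [matchedSet, Set.ofPred_forall]
  exact .iInter fun j => measurable_eval_prodMk j (measurableSet_isMatched (μ j))

variable [Fintype ι]

theorem mem_contIdx {x : ι → ℝ} {j : ι} : j ∈ contIdx μ x ↔ x j ∉ jumps (μ j) := by
  simp only [contIdx, jumps, Finset.mem_filter_univ, Set.mem_ofPred_eq, not_not]

theorem mem_discIdx [DecidableEq ι] {x : ι → ℝ} {j : ι} :
    j ∈ discIdx μ x ↔ x j ∈ jumps (μ j) := by
  rw [discIdx, Finset.mem_compl, mem_contIdx, not_not]

theorem ae_mem_matchedSet : ∀ᵐ p ∂quantileMeasure μ, p ∈ matchedSet μ :=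
  (ae_map_iff (measurable_quantiles_prodMk μ).aemeasurable measurableSet_matchedSet).2
    (ae_cubeMeasure_of_forall_ae fun j => ae_isMatched_quantile (μ j))

theorem jointDensity_eq_indicator [DecidableEq ι] (p : (ι → ℝ) × (ι → ℝ)) :
    jointDensity c μ p.1 p.2 = (matchedSet μ).indicator (fun p => c p.2) p := by
  classical
  have hmem : p ∈ matchedSet μ ↔ (∀ j ∈ contIdx μ p.1, p.2 j = upper μ p.1 j) ∧
      ∀ j ∈ discIdx μ p.1, lower μ p.1 j ≤ p.2 j ∧ p.2 j < upper μ p.1 j := by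
    simp only [mem_contIdx, mem_discIdx]
    exact forall_and
  rw [jointDensity, Finset.prod_ite_zero, Finset.prod_ite_zero, Finset.prod_const_one,
    Finset.prod_const_one, Set.indicator_apply, mul_assoc, ite_zero_mul_ite_zero, mul_one,
    mul_ite, mul_one, mul_zero]
  simp only [hmem]
  congr

theorem withDensity_jointDensity [DecidableEq ι] (ν : Measure ((ι → ℝ) × (ι → ℝ))) :
    ν.withDensity (fun p => ENNReal.ofReal (jointDensity c μ p.1 p.2)) =
      (ν.restrict (matchedSet μ)).withDensity fun p => ENNReal.ofReal (c p.2) := by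
  rw [← withDensity_indicator measurableSet_matchedSet]
  congr 1 with p
  rw [jointDensity_eq_indicator]
  exact (congrFun (Set.indicator_comp_of_zero ENNReal.ofReal_zero) p).symm

theorem quantileMeasure_restrict_matchedSet :
    (quantileMeasure μ).restrict (matchedSet μ) = quantileMeasure μ :=
  Measure.restrict_eq_self_of_ae_mem ae_mem_matchedSet

theorem quantileMeasure_eq_map_pi :
    quantileMeasure μ = (Measure.pi fun j => quantileCoupling (μ j)).map
      fun p => (fun j => (p j).1, fun j => (p j).2) := by
  have hQ : Measurable fun (u : ι → ℝ) j => (quantile (μ j) (u j), u j) :=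
    measurable_pi_lambda _ fun j => (measurable_quantile_prodMk (μ j)).comp (measurable_pi_apply j)
  have : ∀ j, IsProbabilityMeasure (unifMeasure.map fun u => (quantile (μ j) u, u)) :=
    fun j => isProbabilityMeasure_quantileCoupling
  simp only [quantileCoupling]
  rw [← Measure.pi_map_pi fun j => (measurable_quantile_prodMk (μ j)).aemeasurable,
    Measure.map_map measurable_unzip hQ, ← cubeMeasure_eq_pi]
  rfl

instance sigmaFinite_mixedMeasure : SigmaFinite (mixedMeasure μ) := by
  rw [mixedMeasure]
  infer_instance

theorem mixedMeasure_prod_cubeMeasure :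
    (mixedMeasure μ).prod (cubeMeasure ι) =
      (Measure.pi fun j => (lebCount (μ j)).prod unifMeasure).map
        fun p => (fun j => (p j).1, fun j => (p j).2) := by
  rw [cubeMeasure_eq_pi, mixedMeasure]
  exact (measurePreserving_arrowProdEquivProdArrow ℝ ℝ ι
    (fun j => lebCount (μ j)) (fun _ => unifMeasure)).map_eq.symm

theorem map_eq_withDensity_quantileMeasure {Ω : Type*} [MeasurableSpace Ω] {P : Measure Ω}
    {X U : Ω → ι → ℝ} (hc : Measurable c) (hU : AEMeasurable U P)
    (hUc : P.map U = (cubeMeasure ι).withDensity fun u => ENNReal.ofReal (c u))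
    (hXU : X =ᵐ[P] fun ω j => quantile (μ j) (U ω j)) :
    P.map (fun ω => (X ω, U ω)) =
      (quantileMeasure μ).withDensity fun p => ENNReal.ofReal (c p.2) := by
  have hpair : (fun ω => (X ω, U ω)) =ᵐ[P]
      (fun u : ι → ℝ => ((fun j => quantile (μ j) (u j) : ι → ℝ), u)) ∘ U :=
    hXU.mono fun ω hω => Prod.ext hω rfl
  have hc2 : Measurable fun p : (ι → ℝ) × (ι → ℝ) => ENNReal.ofReal (c p.2) :=
    (hc.comp measurable_snd).ennreal_ofReal
  rw [Measure.map_congr hpair, ← AEMeasurable.map_map_of_aemeasurable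
    (measurable_quantiles_prodMk μ).aemeasurable hU, hUc, quantileMeasure,
    withDensity_map _ (measurable_quantiles_prodMk μ) hc2]

theorem ae_eq_quantiles {Ω : Type*} [MeasurableSpace Ω] {P : Measure Ω}
    [DecidableEq ι] {X U : Ω → ι → ℝ} (hU : AEMeasurable U P) (hUc : P.map U ≪ cubeMeasure ι)
    (hXU : ∀ᵐ ω ∂P, (∀ j ∈ contIdx μ (X ω), U ω j = cdf (μ j) (X ω j)) ∧
      ∀ j ∈ discIdx μ (X ω), X ω j = quantile (μ j) (U ω j)) :
    X =ᵐ[P] fun ω j => quantile (μ j) (U ω j) := by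
  have hcont : ∀ᵐ u ∂P.map U, ∀ j t, u j = cdf (μ j) t → t = quantile (μ j) (u j) :=
    hUc.ae_le (ae_cubeMeasure_of_forall_ae fun j => ae_eq_quantile_of_eq_cdf (μ j))
  filter_upwards [ae_of_ae_map hU hcont, hXU] with ω hω hX
  funext j
  by_cases hj : j ∈ contIdx μ (X ω)
  · exact hω j _ (hX.1 j hj)
  · exact hX.2 j (Finset.mem_compl.2 hj)

theorem measurable_prod_latentWeight (hf : ∀ j, Measurable (f j)) :
    Measurable fun p : (ι → ℝ) × (ι → ℝ) => ∏ j, latentWeight (μ j) (f j) (p.1 j) (p.2 j) :=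
  Finset.measurable_fun_prod _ fun j _ =>
    (measurable_latentWeight (hf j)).comp (measurable_eval_prodMk j)

variable (c μ f) in
/-- The density, with respect to `mixedMeasure μ ⊗ cubeMeasure ι`, of the joint law of `X` and `U`
in the coordinates `(x, v)` in which `U = latentLevels μ x v`. -/
def levelDensity (p : (ι → ℝ) × (ι → ℝ)) : ℝ≥0∞ :=
  (∏ j, latentWeight (μ j) (f j) (p.1 j) (p.2 j)) * ENNReal.ofReal (c (latentLevels μ p.1 p.2))

theorem measurable_levelDensity (hc : Measurable c) (hf : ∀ j, Measurable (f j)) :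
    Measurable (levelDensity c μ f) :=
  (measurable_prod_latentWeight hf).mul (hc.comp (measurable_latentLevels μ)).ennreal_ofReal

variable [∀ j, IsProbabilityMeasure (μ j)]

theorem IsMixedMarginal.isFiniteMeasure_withDensity {μ : Measure ℝ} [IsProbabilityMeasure μ]
    {f : ℝ → ℝ} (h : IsMixedMarginal μ f) :
    IsFiniteMeasure ((volume : Measure ℝ).withDensity fun t => ENNReal.ofReal (f t)) := by
  rw [← h.restrict_compl_jumps]
  infer_instance

theorem mixedJointMeasure_restrict_matchedSet (hμ : ∀ j, IsMixedMarginal (μ j) (f j)) :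
    (mixedJointMeasure μ f).restrict (matchedSet μ) = quantileMeasure μ := by
  have hfin := fun j => (hμ j).isFiniteMeasure_withDensity
  have hpre : (fun p : ι → ℝ × ℝ => ((fun j => (p j).1 : ι → ℝ), (fun j => (p j).2 : ι → ℝ))) ⁻¹'
      matchedSet μ = Set.univ.pi fun j => {q | IsMatched (μ j) q.1 q.2} := by
    ext p
    simp only [matchedSet, Set.mem_preimage, Set.mem_ofPred_eq, Set.mem_univ_pi]
  rw [mixedJointMeasure, Measure.restrict_map measurable_unzip measurableSet_matchedSet, hpre,
    Measure.restrict_pi_pi, quantileMeasure_eq_map_pi]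
  simp only [fun j => (hμ j).quantileCoupling_eq_restrict_isMatched]

theorem quantileMeasure_eq_map_latentLevels (hμ : ∀ j, IsMixedMarginal (μ j) (f j)) :
    quantileMeasure μ = (((mixedMeasure μ).prod (cubeMeasure ι)).withDensity fun p =>
      ∏ j, latentWeight (μ j) (f j) (p.1 j) (p.2 j)).map
        fun p => (p.1, latentLevels μ p.1 p.2) := by
  have hweight := fun j => measurable_latentWeight (μ := μ j) (hμ j).measurable
  have hlevel := fun j => measurable_prodMk_latentLevel (μ j)
  have hlevels : Measurable fun (p : ι → ℝ × ℝ) j => ((p j).1, latentLevel (μ j) (p j).1 (p j).2) :=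
    measurable_pi_lambda _ fun j => (hlevel j).comp (measurable_pi_apply j)
  have hprob : ∀ j, IsProbabilityMeasure ((((lebCount (μ j)).prod unifMeasure).withDensity
      fun p => latentWeight (μ j) (f j) p.1 p.2).map fun p => (p.1, latentLevel (μ j) p.1 p.2)) :=
    fun j => (hμ j).quantileCoupling_eq_map_latentLevel ▸ isProbabilityMeasure_quantileCoupling
  rw [quantileMeasure_eq_map_pi, mixedMeasure_prod_cubeMeasure,
    withDensity_map _ measurable_unzip (measurable_prod_latentWeight fun j => (hμ j).measurable),
    Measure.map_map (measurable_prodMk_latentLevels μ) measurable_unzip]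
  simp only [fun j => (hμ j).quantileCoupling_eq_map_latentLevel]
  have hσ : ∀ j, SigmaFinite (((lebCount (μ j)).prod unifMeasure).withDensity
      fun p => latentWeight (μ j) (f j) p.1 p.2) := fun j =>
    (Measure.isFiniteMeasure_of_map (hlevel j).aemeasurable).toSigmaFinite
  rw [← Measure.pi_map_pi fun j => (hlevel j).aemeasurable, ← pi_withDensity hweight,
    Measure.map_map measurable_unzip hlevels]
  rfl

theorem quantileMeasure_withDensity_eq_map_levelDensity (hc : Measurable c)
    (hμ : ∀ j, IsMixedMarginal (μ j) (f j)) :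
    (quantileMeasure μ).withDensity (fun p => ENNReal.ofReal (c p.2)) =
      (((mixedMeasure μ).prod (cubeMeasure ι)).withDensity (levelDensity c μ f)).map
        fun p => (p.1, latentLevels μ p.1 p.2) := by
  have hc2 : Measurable fun p : (ι → ℝ) × (ι → ℝ) => ENNReal.ofReal (c p.2) :=
    (hc.comp measurable_snd).ennreal_ofReal
  have hlevels := measurable_prodMk_latentLevels μ
  rw [quantileMeasure_eq_map_latentLevels hμ, withDensity_map _ hlevels hc2]
  congr 1
  exact (withDensity_mul _ (measurable_prod_latentWeight fun j => (hμ j).measurable)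
    (hc2.comp hlevels)).symm

end JointLaw

section RectDiff

variable {κ : Type*} [Fintype κ]

theorem indicator_Ioc_eq_sub {s t : ℝ} (hst : s ≤ t) (w : ℝ) :
    (Set.Ioc s t).indicator (1 : ℝ → ℝ) w =
      (Set.Iic t).indicator 1 w - (Set.Iic s).indicator 1 w := by
  rw [← Set.Iic_sdiff_Iic, Set.indicator_sdiff (Set.Iic_subset_Iic.2 hst), Pi.sub_apply]

theorem indicator_univ_pi_eq_mul_prod (t : κ → Set ℝ) (g : (κ → ℝ) → ℝ) (w : κ → ℝ) :
    (Set.univ.pi t).indicator g w = g w * ∏ j, (t j).indicator 1 (w j) := by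
  rw [← Set.indicator_pi_one_apply, Finset.coe_univ, ← Set.indicator_mul_right]
  simp only [Pi.one_apply, mul_one]

variable [DecidableEq κ] {a b : κ → ℝ} {g : (κ → ℝ) → ℝ}

theorem rectDiff_prod (h : κ → ℝ → ℝ) :
    rectDiff a b (fun v => ∏ j, h j (v j)) = ∏ j, (h j (b j) - h j (a j)) := by
  rw [rectDiff, Finset.prod_sub, Finset.powerset_univ]
  refine Finset.sum_congr rfl fun T _ => ?_
  have hvertex : ∀ j, h j (if j ∈ T then a j else b j) = if j ∈ T then h j (a j) else h j (b j) :=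
    fun j => apply_ite (h j) _ _ _
  simp only [hvertex, Finset.prod_ite, Finset.filter_univ_mem, Finset.filter_notMem_eq_sdiff]
  ring

theorem rectDiff_indicator_Iic (hab : a ≤ b) (w : κ → ℝ) :
    rectDiff a b (fun v => (Set.Iic v).indicator g w) =
      (Set.univ.pi fun j => Set.Ioc (a j) (b j)).indicator g w := by
  have hprod := rectDiff_prod (a := a) (b := b) fun j t => (Set.Iic t).indicator 1 (w j)
  simp only [← indicator_Ioc_eq_sub (hab _)] at hprod
  rw [indicator_univ_pi_eq_mul_prod, ← hprod]
  simp only [rectDiff, ← Set.pi_univ_Iic, indicator_univ_pi_eq_mul_prod, Finset.mul_sum,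
    mul_left_comm (g w)]

theorem rectDiff_setIntegral_Iic {ν : Measure (κ → ℝ)} (hab : a ≤ b)
    (hg : Integrable g ν) :
    rectDiff a b (fun v => ∫ w in Set.Iic v, g w ∂ν) =
      ∫ w in Set.univ.pi fun j => Set.Ioc (a j) (b j), g w ∂ν := by
  have hbox : MeasurableSet (Set.univ.pi fun j => Set.Ioc (a j) (b j)) :=
    .univ_pi fun j => measurableSet_Ioc
  simp only [rectDiff, ← integral_indicator measurableSet_Iic, ← integral_indicator hbox,
    ← integral_const_mul]
  rw [← integral_finsetSum _ fun T _ => (hg.indicator measurableSet_Iic).const_mul _]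
  exact integral_congr_ae (Filter.Eventually.of_forall (rectDiff_indicator_Iic hab))

theorem rectDiff_setIntegral_Icc_inter_Iic (hab : a ≤ b) (hg : Integrable g (cubeMeasure κ)) :
    rectDiff a b (fun v => ∫ w in Set.Icc 0 1 ∩ Set.Iic v, g w) =
      ∫ w in Set.univ.pi fun j => Set.Ico (a j) (b j), g w ∂cubeMeasure κ := by
  have hIoc : (Set.univ.pi fun j => Set.Ioc (a j) (b j)) =ᵐ[cubeMeasure κ]
      Set.univ.pi fun j => Set.Ico (a j) (b j) :=
    ae_restrict_le ((Measure.univ_pi_Ioc_ae_eq_Icc (μ := fun _ : κ => (volume : Measure ℝ))).trans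
      Measure.univ_pi_Ico_ae_eq_Icc.symm)
  rw [← setIntegral_congr_set hIoc, ← rectDiff_setIntegral_Iic hab hg]
  simp only [cubeMeasure, Measure.restrict_restrict measurableSet_Iic, Set.inter_comm]

end RectDiff

section Slices

theorem map_restrict_cubeMeasure {ι : Type*} [Fintype ι] (T : Finset ι) :
    (cubeMeasure ι).map T.restrict = cubeMeasure T := by
  rw [cubeMeasure_eq_pi, cubeMeasure_eq_pi, ← Measure.infinitePi_eq_pi,
    Measure.infinitePi_map_restrict]

theorem lintegral_comp_restrict {ι : Type*} [Fintype ι] {T : Finset ι} {g : (T → ℝ) → ℝ≥0∞}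
    (hg : Measurable g) : ∫⁻ u, g (T.restrict u) ∂cubeMeasure ι = ∫⁻ v, g v ∂cubeMeasure T := by
  rw [← map_restrict_cubeMeasure, lintegral_map hg (Finset.measurable_restrict T)]

variable {ι : Type*} [Fintype ι] [DecidableEq ι] {c : (ι → ℝ) → ℝ} {μ : ι → Measure ℝ}
  {f : ι → ℝ → ℝ} {x : ι → ℝ}

theorem glue_restrict (S : Finset ι) (u : ι → ℝ) (v : ↥Sᶜ → ℝ) :
    glue S (S.restrict u) v = Function.updateFinset u Sᶜ v := by
  funext j
  by_cases hj : j ∈ S <;> simp [glue, Function.updateFinset, hj]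

variable (c μ x) in
/-- The copula density on the slice of the cube on which the coordinates in `𝒞(x)` are fixed at
`b_𝒞(x)`: the numerator `c(b_𝒞(x), v)` of the conditional copula density. -/
def slice (v : ↥(discIdx μ x) → ℝ) : ℝ :=
  c (glue (contIdx μ x) ((contIdx μ x).restrict (upper μ x)) v)

variable (μ x) in
/-- The box `a_j ≤ v_j < b_j`, `j ∈ 𝒟(x)`, of latent values compatible with `x`. -/
def sliceBox : Set (↥(discIdx μ x) → ℝ) :=
  Set.univ.pi fun j => Set.Ico (lower μ x j) (upper μ x j)

theorem measurableSet_sliceBox : MeasurableSet (sliceBox μ x) :=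
  .univ_pi fun _ => measurableSet_Ico

theorem sliceBox_subset_Icc : sliceBox μ x ⊆ Set.Icc 0 1 := fun _ hv =>
  ⟨fun j => (Ico_leftLim_cdf_subset_Icc (μ j) (x j) (hv j trivial)).1,
    fun j => (Ico_leftLim_cdf_subset_Icc (μ j) (x j) (hv j trivial)).2⟩

theorem slice_eq_updateFinset (v : ↥(discIdx μ x) → ℝ) :
    slice c μ x v = c (Function.updateFinset (upper μ x) (discIdx μ x) v) := by
  rw [slice, glue_restrict]

theorem measurable_slice (hc : Measurable c) : Measurable (slice c μ x) := by
  simp only [funext slice_eq_updateFinset]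
  exact hc.comp measurable_updateFinset

theorem slice_restrict (u : ι → ℝ) :
    slice c μ x ((discIdx μ x).restrict u) = c (latentLevels μ x u) := by
  rw [slice_eq_updateFinset]
  congr 1 with j
  by_cases hj : x j ∈ jumps (μ j) <;>
    simp [latentLevels, latentLevel, Function.updateFinset, mem_contIdx, upper, hj]

theorem restrict_latentLevels (u : ι → ℝ) :
    (discIdx μ x).restrict (latentLevels μ x u) = (discIdx μ x).restrict u :=
  funext fun j => if_pos (mem_discIdx.1 j.2)

theorem prod_latentWeight (hf : ∀ j t, 0 ≤ f j t) (u : ι → ℝ) :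
    ∏ j, latentWeight (μ j) (f j) (x j) (u j) =
      ENNReal.ofReal (∏ j ∈ contIdx μ x, f j (x j)) *
        (sliceBox μ x).indicator 1 ((discIdx μ x).restrict u) := by
  have hcont : ∏ j ∈ contIdx μ x, latentWeight (μ j) (f j) (x j) (u j) =
      ENNReal.ofReal (∏ j ∈ contIdx μ x, f j (x j)) := by
    rw [ENNReal.ofReal_prod_of_nonneg fun j _ => hf j _]
    exact Finset.prod_congr rfl fun j hj => if_neg (mem_contIdx.1 hj)
  have hdisc : ∏ j ∈ discIdx μ x, latentWeight (μ j) (f j) (x j) (u j) =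
      (sliceBox μ x).indicator 1 ((discIdx μ x).restrict u) := by
    rw [← Finset.prod_coe_sort, sliceBox, ← Finset.coe_univ, Set.indicator_pi_one_apply]
    refine Finset.prod_congr rfl fun j _ => (if_pos (mem_discIdx.1 j.2)).trans ?_
    rfl
  rw [← Finset.prod_mul_prod_compl (contIdx μ x), hcont, hdisc]

theorem levelDensity_apply (hf : ∀ j t, 0 ≤ f j t) (u : ι → ℝ) :
    levelDensity c μ f (x, u) = ENNReal.ofReal (∏ j ∈ contIdx μ x, f j (x j)) *
      (sliceBox μ x).indicator (fun v => ENNReal.ofReal (slice c μ x v))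
        ((discIdx μ x).restrict u) := by
  by_cases hu : (discIdx μ x).restrict u ∈ sliceBox μ x <;>
    simp [levelDensity, prod_latentWeight hf, ← slice_restrict (c := c) u, hu]

theorem fstDensity_levelDensity (hc : Measurable c) (hf : ∀ j t, 0 ≤ f j t) :
    fstDensity (cubeMeasure ι) (levelDensity c μ f) x =
      ENNReal.ofReal (∏ j ∈ contIdx μ x, f j (x j)) *
        ∫⁻ v in sliceBox μ x, ENNReal.ofReal (slice c μ x v) ∂cubeMeasure ↥(discIdx μ x) := by
  simp only [fstDensity, levelDensity_apply hf]
  rw [lintegral_const_mul' _ _ ENNReal.ofReal_ne_top, lintegral_comp_restrict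
    ((measurable_slice hc).ennreal_ofReal.indicator measurableSet_sliceBox),
    lintegral_indicator measurableSet_sliceBox]

theorem margDensity_mul_condRectDiff (hc : ∀ u, 0 ≤ c u)
    (hx : Integrable (slice c μ x) (cubeMeasure ↥(discIdx μ x))) :
    margDensity c (contIdx μ x) ((contIdx μ x).restrict (upper μ x)) * condRectDiff c μ x =
      ∫ v in sliceBox μ x, slice c μ x v ∂cubeMeasure ↥(discIdx μ x) := by
  have hdiff : condRectDiff c μ x = ∫ v in sliceBox μ x, slice c μ x v /
      margDensity c (contIdx μ x) ((contIdx μ x).restrict (upper μ x))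
        ∂cubeMeasure ↥(discIdx μ x) :=
    rectDiff_setIntegral_Icc_inter_Iic (fun _ => leftLim_cdf_le _ _) (hx.div_const _)
  rw [hdiff, integral_div]
  by_cases hm : margDensity c (contIdx μ x) ((contIdx μ x).restrict (upper μ x)) = 0
  · have hzero : slice c μ x =ᵐ[cubeMeasure ↥(discIdx μ x)] 0 :=
      (integral_eq_zero_iff_of_nonneg (fun v => hc _) hx).1 hm
    rw [hm, zero_mul, integral_congr_ae (ae_restrict_of_ae hzero), integral_zero']
  · exact mul_div_cancel₀ _ hm

theorem latentDensity_eq (v : ↥(discIdx μ x) → ℝ) :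
    latentDensity c μ x v = (sliceBox μ x).indicator (slice c μ x) v /
      (margDensity c (contIdx μ x) ((contIdx μ x).restrict (upper μ x)) *
        condRectDiff c μ x) := by
  classical
  rw [sliceBox, indicator_univ_pi_eq_mul_prod]
  simp only [latentDensity, condDensity, slice, Set.indicator_apply, Set.mem_Ico, Pi.one_apply,
    ← div_div, div_mul_eq_mul_div]

end Slices

section Likelihood

variable {ι : Type*} [Fintype ι] [DecidableEq ι] {c : (ι → ℝ) → ℝ} {μ : ι → Measure ℝ}
  {f : ι → ℝ → ℝ} {x : ι → ℝ}

theorem fstDensity_levelDensity_of_integrable (hc : Measurable c) (hc0 : ∀ u, 0 ≤ c u)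
    (hf : ∀ j t, 0 ≤ f j t) (hx : Integrable (slice c μ x) (cubeMeasure ↥(discIdx μ x))) :
    fstDensity (cubeMeasure ι) (levelDensity c μ f) x =
      ENNReal.ofReal (∏ j ∈ contIdx μ x, f j (x j)) * ENNReal.ofReal (margDensity c (contIdx μ x)
        ((contIdx μ x).restrict (upper μ x)) * condRectDiff c μ x) := by
  rw [fstDensity_levelDensity hc hf, margDensity_mul_condRectDiff hc0 hx,
    ofReal_integral_eq_lintegral_ofReal hx.restrict (.of_forall fun _ => hc0 _)]

theorem ofReal_likelihood (hc : Measurable c) (hc0 : ∀ u, 0 ≤ c u) (hf : ∀ j t, 0 ≤ f j t)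
    (hx : Integrable (slice c μ x) (cubeMeasure ↥(discIdx μ x))) :
    ENNReal.ofReal (likelihood c μ f x) = fstDensity (cubeMeasure ι) (levelDensity c μ f) x := by
  rw [fstDensity_levelDensity_of_integrable hc hc0 hf hx, likelihood,
    mul_comm (margDensity _ _ _), mul_assoc,
    ENNReal.ofReal_mul (Finset.prod_nonneg fun j _ => hf j _)]

theorem likelihood_eq_zero_of_not_integrable
    (hx : ¬ Integrable (slice c μ x) (cubeMeasure ↥(discIdx μ x))) : likelihood c μ f x = 0 := by
  have hmarg : margDensity c (contIdx μ x) ((contIdx μ x).restrict (upper μ x)) = 0 :=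
    integral_undef hx
  rw [likelihood, hmarg, zero_mul, zero_mul]

theorem volume_withDensity_latentDensity :
    (volume : Measure (↥(discIdx μ x) → ℝ)).withDensity
        (fun v => ENNReal.ofReal (latentDensity c μ x v)) =
      (cubeMeasure ↥(discIdx μ x)).withDensity
        fun v => ENNReal.ofReal (latentDensity c μ x v) := by
  rw [cubeMeasure, ← withDensity_indicator measurableSet_Icc, Set.indicator_eq_self.2]
  refine Function.support_subset_iff'.2 fun v hv => ?_
  rw [latentDensity_eq, Set.indicator_of_notMem fun hbox => hv (sliceBox_subset_Icc hbox),
    zero_div, ENNReal.ofReal_zero]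

theorem ofReal_latentDensity (hc : Measurable c) (hc0 : ∀ u, 0 ≤ c u) (hf : ∀ j t, 0 ≤ f j t)
    (hx : Integrable (slice c μ x) (cubeMeasure ↥(discIdx μ x)))
    (hpos : fstDensity (cubeMeasure ι) (levelDensity c μ f) x ≠ 0) (v : ↥(discIdx μ x) → ℝ) :
    ENNReal.ofReal (latentDensity c μ x v) =
      (fstDensity (cubeMeasure ι) (levelDensity c μ f) x)⁻¹ *
        (ENNReal.ofReal (∏ j ∈ contIdx μ x, f j (x j)) *
          (sliceBox μ x).indicator (fun v => ENNReal.ofReal (slice c μ x v)) v) := by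
  have hbox : (sliceBox μ x).indicator (fun v => ENNReal.ofReal (slice c μ x v)) v =
      ENNReal.ofReal ((sliceBox μ x).indicator (slice c μ x) v) :=
    congrFun (Set.indicator_comp_of_zero ENNReal.ofReal_zero) v
  rw [fstDensity_levelDensity_of_integrable hc hc0 hf hx] at hpos ⊢
  obtain ⟨hprod, hdiff⟩ := mul_ne_zero_iff.1 hpos
  have hdiff_pos := ENNReal.ofReal_pos.1 (pos_iff_ne_zero.2 hdiff)
  rw [latentDensity_eq, ENNReal.ofReal_div_of_pos hdiff_pos, hbox, ENNReal.div_eq_inv_mul,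
    ENNReal.mul_inv (.inl hprod) (.inl ENNReal.ofReal_ne_top),
    mul_mul_mul_comm, ENNReal.inv_mul_cancel hprod ENNReal.ofReal_ne_top, one_mul]

theorem map_sndKernel_levelDensity (hc : Measurable c) (hc0 : ∀ u, 0 ≤ c u)
    (hf : ∀ j, Measurable (f j)) (hf0 : ∀ j t, 0 ≤ f j t)
    (hx : Integrable (slice c μ x) (cubeMeasure ↥(discIdx μ x)))
    (hpos : fstDensity (cubeMeasure ι) (levelDensity c μ f) x ≠ 0) :
    ((sndKernel (cubeMeasure ι) (levelDensity c μ f) x).map (latentLevels μ x)).map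
        (discIdx μ x).restrict =
      (volume : Measure (↥(discIdx μ x) → ℝ)).withDensity
        fun v => ENNReal.ofReal (latentDensity c μ x v) := by
  have hr := Finset.measurable_restrict (X := fun _ : ι => ℝ) (discIdx μ x)
  have hlevels : Measurable (latentLevels μ x) :=
    (measurable_latentLevels μ).comp measurable_prodMk_left
  have hcomp : (discIdx μ x).restrict ∘ latentLevels μ x =
      (discIdx μ x).restrict (π := fun _ => ℝ) := funext restrict_latentLevels
  have hdensity : Measurable fun v => (fstDensity (cubeMeasure ι) (levelDensity c μ f) x)⁻¹ *
      (ENNReal.ofReal (∏ j ∈ contIdx μ x, f j (x j)) *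
        (sliceBox μ x).indicator (fun v => ENNReal.ofReal (slice c μ x v)) v) :=
    (((measurable_slice hc).ennreal_ofReal.indicator measurableSet_sliceBox).const_mul _).const_mul
      _
  rw [Measure.map_map hr hlevels, hcomp, volume_withDensity_latentDensity,
    sndKernel_apply (measurable_levelDensity hc hf)]
  simp only [levelDensity_apply hf0]
  rw [← withDensity_map _ hr hdensity, map_restrict_cubeMeasure]
  congr 1 with v
  exact (ofReal_latentDensity hc hc0 hf0 hx hpos v).symm

theorem lintegral_slice :
    ∫⁻ v, ENNReal.ofReal (slice c μ x v) ∂cubeMeasure ↥(discIdx μ x) =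
      (∫⋯∫⁻_discIdx μ x, (fun u => ENNReal.ofReal (c u)) ∂fun _ => unifMeasure) (upper μ x) := by
  simp only [slice_eq_updateFinset, cubeMeasure_eq_pi, lmarginal]

theorem integrable_slice_iff (hc : Measurable c) (hc0 : ∀ u, 0 ≤ c u) :
    Integrable (slice c μ x) (cubeMeasure ↥(discIdx μ x)) ↔
      ∫⁻ v, ENNReal.ofReal (slice c μ x v) ∂cubeMeasure ↥(discIdx μ x) < ∞ := by
  have hnonneg : ∀ v, 0 ≤ slice c μ x v := fun _ => hc0 _
  rw [← hasFiniteIntegral_iff_ofReal (.of_forall hnonneg)]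
  exact and_iff_right (measurable_slice hc).aestronglyMeasurable

theorem measurableSet_integrable_slice (hc : Measurable c) (hc0 : ∀ u, 0 ≤ c u) :
    MeasurableSet {x | Integrable (slice c μ x) (cubeMeasure ↥(discIdx μ x))} := by
  have hlintegral : ∀ x, ∫⁻ v, ENNReal.ofReal (slice c μ x v) ∂cubeMeasure ↥(discIdx μ x) =
      ∫⁻ u, ENNReal.ofReal (c (latentLevels μ x u)) ∂cubeMeasure ι := fun x => by
    simp only [← lintegral_comp_restrict (measurable_slice hc).ennreal_ofReal, slice_restrict]
  simp only [integrable_slice_iff hc hc0, hlintegral]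
  exact measurableSet_lt (hc.comp (measurable_latentLevels μ)).ennreal_ofReal.lintegral_prod_right'
    measurable_const

theorem ae_forall_isMatched_integrable_slice (hc : Measurable c) (hc0 : ∀ u, 0 ≤ c u)
    (hfin : ∫⁻ u, ENNReal.ofReal (c u) ∂cubeMeasure ι ≠ ∞) :
    ∀ᵐ u ∂cubeMeasure ι, ∀ x : ι → ℝ, (∀ j, IsMatched (μ j) (x j) (u j)) →
      Integrable (slice c μ x) (cubeMeasure ↥(discIdx μ x)) := by
  have hmarg : ∀ᵐ u ∂cubeMeasure ι, ∀ S : Finset ι,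
      (∫⋯∫⁻_S, (fun u => ENNReal.ofReal (c u)) ∂fun _ => unifMeasure) u < ∞ := by
    rw [cubeMeasure_eq_pi] at hfin ⊢
    exact ae_all_iff.2 (ae_lmarginal_lt_top hc.ennreal_ofReal hfin)
  filter_upwards [hmarg] with u hu x hmatch
  have hupper : ∀ j ∉ discIdx μ x, upper μ x j = u j := fun j hj =>
    ((hmatch j).1 (mem_contIdx.1 (Finset.notMem_compl.1 hj))).symm
  rw [integrable_slice_iff hc hc0, lintegral_slice]
  exact (lmarginal_congr _ _ hupper).trans_lt (hu _)

variable {Ω : Type*} [MeasurableSpace Ω] {P : Measure Ω} {X U : Ω → ι → ℝ}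

theorem ae_map_integrable_slice (hc : Measurable c) (hc0 : ∀ u, 0 ≤ c u)
    (hfin : ∫⁻ u, ENNReal.ofReal (c u) ∂cubeMeasure ι ≠ ∞) (hX : AEMeasurable X P)
    (hU : AEMeasurable U P) (hUc : P.map U ≪ cubeMeasure ι)
    (hXU : X =ᵐ[P] fun ω j => quantile (μ j) (U ω j)) :
    ∀ᵐ x ∂P.map X, Integrable (slice c μ x) (cubeMeasure ↥(discIdx μ x)) := by
  have hslice := ae_of_ae_map hU
    (hUc.ae_le (ae_forall_isMatched_integrable_slice (μ := μ) hc hc0 hfin))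
  have hmatch := ae_of_ae_map hU
    (hUc.ae_le (ae_cubeMeasure_of_forall_ae fun j => ae_isMatched_quantile (μ j)))
  rw [ae_map_iff hX (measurableSet_integrable_slice hc hc0)]
  filter_upwards [hslice, hmatch, hXU] with ω hω hmatchω hXω
  exact hω _ (hXω ▸ hmatchω)

theorem withDensity_fstDensity_levelDensity (hc : Measurable c) (hc0 : ∀ u, 0 ≤ c u)
    (hf : ∀ j, Measurable (f j)) (hf0 : ∀ j t, 0 ≤ f j t)
    (hslice : ∀ᵐ x ∂(mixedMeasure μ).withDensity (fstDensity (cubeMeasure ι) (levelDensity c μ f)),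
      Integrable (slice c μ x) (cubeMeasure ↥(discIdx μ x))) :
    (mixedMeasure μ).withDensity (fstDensity (cubeMeasure ι) (levelDensity c μ f)) =
      (mixedMeasure μ).withDensity fun x => ENNReal.ofReal (likelihood c μ f x) := by
  refine withDensity_congr_ae ?_
  filter_upwards [(ae_withDensity_iff
    (measurable_fstDensity (measurable_levelDensity hc hf))).1 hslice] with x hx
  by_cases hint : Integrable (slice c μ x) (cubeMeasure ↥(discIdx μ x))
  · exact (ofReal_likelihood hc hc0 hf0 hint).symm
  · rw [likelihood_eq_zero_of_not_integrable hint, ENNReal.ofReal_zero]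
    exact not_not.1 fun hne => hint (hx hne)

end Likelihood

theorem lemma4_general {ι : Type*} [Fintype ι] [DecidableEq ι] {Ω : Type*} [MeasurableSpace Ω]
    (P : Measure Ω) [IsFiniteMeasure P] {c : (ι → ℝ) → ℝ} (hc : Measurable c) (hc0 : ∀ u, 0 ≤ c u)
    (μ : ι → Measure ℝ) [∀ j, IsProbabilityMeasure (μ j)] (f : ι → ℝ → ℝ)
    (hμ : ∀ j, IsMixedMarginal (μ j) (f j)) (X U : Ω → ι → ℝ) (hU : AEMeasurable U P)
    (hUc : P.map U = (cubeMeasure ι).withDensity fun u => ENNReal.ofReal (c u))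
    (hXU : ∀ᵐ ω ∂P, (∀ j ∈ contIdx μ (X ω), U ω j = cdf (μ j) (X ω j)) ∧
      ∀ j ∈ discIdx μ (X ω), X ω j = quantile (μ j) (U ω j)) :
    (P.map (fun ω => (X ω, U ω)) = (quantileMeasure μ).withDensity
        (fun p => ENNReal.ofReal (jointDensity c μ p.1 p.2)) ∧
      P.map (fun ω => (X ω, U ω)) = (mixedJointMeasure μ f).withDensity
        (fun p => ENNReal.ofReal (jointDensity c μ p.1 p.2))) ∧
    P.map X = (mixedMeasure μ).withDensity (fun x => ENNReal.ofReal (likelihood c μ f x)) ∧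
    ∀ᵐ x ∂(P.map X), (condDistrib U X P x).map (discIdx μ x).restrict =
      (volume : Measure (↥(discIdx μ x) → ℝ)).withDensity
        (fun v => ENNReal.ofReal (latentDensity c μ x v)) := by
  have hf := fun j => (hμ j).measurable
  have hf0 := fun j => (hμ j).nonneg
  have hUac : P.map U ≪ cubeMeasure ι := hUc ▸ withDensity_absolutelyContinuous _ _
  have hXQ := ae_eq_quantiles hU hUac hXU
  have hX := ((measurable_quantiles_prodMk μ).fst.comp_aemeasurable hU).congr hXQ.symm
  have hjoint := map_eq_withDensity_quantileMeasure hc hU hUc hXQ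
  have hlevel := hjoint.trans (quantileMeasure_withDensity_eq_map_levelDensity hc hμ)
  have hD := measurable_levelDensity (μ := μ) hc hf
  have hPX := map_eq_withDensity_fstDensity hX hU hD (measurable_latentLevels μ) hlevel
  have hfin : ∫⁻ u, ENNReal.ofReal (c u) ∂cubeMeasure ι ≠ ∞ := by
    rw [← setLIntegral_univ, ← withDensity_apply _ .univ, ← hUc]
    exact measure_ne_top _ _
  have hslice := ae_map_integrable_slice hc hc0 hfin hX hU hUac hXQ
  have hcond := condDistrib_ae_eq_map_sndKernel hX hU hD (measurable_latentLevels μ) hlevel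
  have hpos : ∀ᵐ x ∂P.map X, fstDensity (cubeMeasure ι) (levelDensity c μ f) x ≠ 0 :=
    hPX ▸ ae_withDensity_fstDensity_ne_zero hD
  refine ⟨⟨?_, ?_⟩, ?_, ?_⟩
  · rw [withDensity_jointDensity, quantileMeasure_restrict_matchedSet, hjoint]
  · rw [withDensity_jointDensity, mixedJointMeasure_restrict_matchedSet hμ, hjoint]
  · rw [hPX, withDensity_fstDensity_levelDensity hc hc0 hf hf0 (hPX ▸ hslice)]
  · filter_upwards [hcond, hslice, hpos] with x hcondx hslicex hposx
    rw [hcondx, map_sndKernel_levelDensity hc hc0 hf hf0 hslicex hposx]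

end MixedCopula

end

open MixedCopula in
theorem lemma4 {m : ℕ} {Ω : Type*} [MeasurableSpace Ω] (P : Measure Ω) [IsProbabilityMeasure P]
    (C c : (Fin m → ℝ) → ℝ) (hC : MixedCopula.IsCopula C) (hc : MixedCopula.IsCopulaDensity C c)
    (μ : Fin m → Measure ℝ) [∀ j, IsProbabilityMeasure (μ j)] (f : Fin m → ℝ → ℝ)
    (hμ : ∀ j, MixedCopula.IsMixedMarginal (μ j) (f j))
    (X U : Ω → Fin m → ℝ) (hX : Measurable X) (hU : Measurable U)
    (hUC : ∀ u, P.real {ω | U ω ≤ u} = C u)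
    (hXU : ∀ᵐ ω ∂P,
      (∀ j ∈ MixedCopula.contIdx μ (X ω), U ω j = cdf (μ j) (X ω j)) ∧
      ∀ j ∈ MixedCopula.discIdx μ (X ω), X ω j = MixedCopula.quantile (μ j) (U ω j)) :
    -- (i)
    (P.map (fun ω => (X ω, U ω)) = (MixedCopula.quantileMeasure μ).withDensity
        (fun p => ENNReal.ofReal (MixedCopula.jointDensity c μ p.1 p.2)) ∧
      P.map (fun ω => (X ω, U ω)) = (MixedCopula.mixedJointMeasure μ f).withDensity
        (fun p => ENNReal.ofReal (MixedCopula.jointDensity c μ p.1 p.2))) ∧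
    -- (ii)
    P.map X = (MixedCopula.mixedMeasure μ).withDensity
      (fun x => ENNReal.ofReal (MixedCopula.likelihood c μ f x)) ∧
    -- (iii)
    ∀ᵐ x ∂(P.map X),
      (condDistrib U X P x).map (MixedCopula.discIdx μ x).restrict =
        (volume : Measure (↥(MixedCopula.discIdx μ x) → ℝ)).withDensity
          (fun v => ENNReal.ofReal (MixedCopula.latentDensity c μ x v)) :=
  lemma4_general P hc.measurable hc.nonneg μ f hμ X U hU.aemeasurable
    (hc.eq_withDensity hC fun u => by rw [map_measureReal_apply hU measurableSet_Iic]; exact hUC u)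
    hXU
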